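/- Let $\Gamma$ be a finite simplicial graph with vertex set $V$, edge set $E$ and an edge labeling $m\colon E\to\{2,3,4,\dots\}$, and let $$A_\Gamma=\langle V \mid \underbrace{vwv\cdots}_{m(\{v,w\})\text{ letters}}=\underbrace{wvw\cdots}_{m(\{v,w\})\text{ letters}}\ \text{ for all } \{v,w\}\in E\rangle$$ be the associated Artin group. For $X\subseteq V$ let $A_X$ be the subgroup of $A_\Gamma$ generated by $X$. A subgroup of $A_\Gamma$ is called parabolic if it equals $gA_Xg^{-1}$ for some $g\in A_\Gamma$ and $X\subseteq V$, and complete parabolic if moreover $X$ can be chosen such that any two distinct vertices of $X$ are joined by an edge of $\Gamma$. A group $G$ is called an ${\rm F}\mathcal{A}'$-group if, for every simplicial action of $G$ without inversion on a tree, every element of $G$ has a fixed point. Assume that $A_\Gamma$ has property (Int++), that is, for all parabolic subgroups $P_1,P_2$ of $A_\Gamma$ the intersection $P_1\cap P_2$ is again a parabolic subgroup. Let $H\subseteq A_\Gamma$ be a subgroup. If $H$ is an ${\rm F}\mathcal{A}'$-group, then $H$ is contained in a complete parabolic subgroup of $A_\Gamma$. -/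

import Mathlib

universe u

/-- The alternating product `a * b * a * ⋯` with `n` factors, beginning with `a`. -/
def alternatingProd {M : Type u} [Monoid M] : M → M → ℕ → M
  | _, _, 0 => 1
  | a, b, n + 1 => a * alternatingProd b a n

/-- The relators `(v w v ⋯) (w v w ⋯)⁻¹`, with `m {v, w}` letters in each word, one for each
ordered pair of adjacent vertices of the edge-labeled graph `(Γ, m)`. -/
def artinRelators {V : Type u} (Γ : SimpleGraph V) (m : Γ.edgeSet → ℕ) : Set (FreeGroup V) :=
  {r | ∃ (v w : V) (h : Γ.Adj v w),
    r = alternatingProd (FreeGroup.of v) (FreeGroup.of w) (m ⟨s(v, w), h⟩) *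
      (alternatingProd (FreeGroup.of w) (FreeGroup.of v) (m ⟨s(v, w), h⟩))⁻¹}

/-- The Artin group of the edge-labeled graph `(Γ, m)`. -/
abbrev ArtinGroup {V : Type u} (Γ : SimpleGraph V) (m : Γ.edgeSet → ℕ) : Type u :=
  PresentedGroup (artinRelators Γ m)

namespace ArtinGroup

variable {V : Type u} {Γ : SimpleGraph V} {m : Γ.edgeSet → ℕ}

/-- The standard generator attached to a vertex. -/
def gen (Γ : SimpleGraph V) (m : Γ.edgeSet → ℕ) (v : V) : ArtinGroup Γ m :=
  PresentedGroup.of v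

/-- The standard parabolic subgroup `A_X`, generated by the vertices in `X`. -/
def standardParabolic (Γ : SimpleGraph V) (m : Γ.edgeSet → ℕ) (X : Set V) :
    Subgroup (ArtinGroup Γ m) :=
  Subgroup.closure (gen Γ m '' X)

/-- A parabolic subgroup is a conjugate `g A_X g⁻¹` of a standard parabolic subgroup. -/
def IsParabolic (P : Subgroup (ArtinGroup Γ m)) : Prop :=
  ∃ (g : ArtinGroup Γ m) (X : Set V),
    P = (standardParabolic Γ m X).map (MulAut.conj g).toMonoidHom

/-- A complete parabolic subgroup is a conjugate `g A_X g⁻¹` where any two distinct vertices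
of `X` are adjacent in `Γ`. -/
def IsCompleteParabolic (P : Subgroup (ArtinGroup Γ m)) : Prop :=
  ∃ (g : ArtinGroup Γ m) (X : Set V), Γ.IsClique X ∧
    P = (standardParabolic Γ m X).map (MulAut.conj g).toMonoidHom

/-- Property (Int++): the intersection of any two parabolic subgroups is parabolic. -/
def PropertyIntPlusPlus (Γ : SimpleGraph V) (m : Γ.edgeSet → ℕ) : Prop :=
  ∀ P₁ P₂ : Subgroup (ArtinGroup Γ m), IsParabolic P₁ → IsParabolic P₂ → IsParabolic (P₁ ⊓ P₂)

end ArtinGroup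

/-- A simplicial action of `G` on a graph `T` is without inversion if no element of `G`
exchanges the two ends of an edge. -/
def ActsWithoutInversion {G : Type u} [Group G] {W : Type u} {T : SimpleGraph W}
    (ψ : G →* (T ≃g T)) : Prop :=
  ∀ (g : G) (x y : W), T.Adj x y → ¬ (ψ g x = y ∧ ψ g y = x)

/-- `G` is an `FA'`-group: for every simplicial action of `G` without inversion on a tree, each
element of `G` is elliptic. As there are no inversions, an automorphism that fixes a point of the
geometric realization fixes a vertex, so being elliptic is expressed by a fixed vertex. Trees are
taken in the universe of `G`; this is no restriction, as the subtree spanned by one orbit has at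
most `max (#G) ℵ₀` vertices, and an element that fixes a point of the tree fixes a point of every
nonempty invariant subtree. -/
def IsFAPrimeGroup (G : Type u) [Group G] : Prop :=
  ∀ (W : Type u) (T : SimpleGraph W), T.IsTree →
    ∀ ψ : G →* (T ≃g T), ActsWithoutInversion ψ → ∀ g : G, ∃ x : W, ψ g x = x

/-! If `v` and `w` are not adjacent, every defining relation of the Artin group avoids `v` or avoids
`w`. The group is therefore the amalgam of the two standard parabolic subgroups on the complements
of `v` and of `w`, and it acts on the Bass-Serre tree (`isTree_cosetGraph_factor`). Vertex
stabilizers are parabolic, and the generators `v` and `w` have no common fixed vertex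
(`not_gen_common_fixedPoint`).

An FA'-subgroup `H` acts on this tree by elliptic elements but need not fix a vertex. Serre's lemma
(`IsTree.exists_forall_apply_eq`) only gives a vertex fixed by a prescribed finite subset. The gap
is closed by rank. Call the number of generators of a parabolic subgroup its rank. An inclusion of
parabolic subgroups cannot lower the rank, and it is an equality if the ranks agree
(`ncard_le_and_eq_of_map_conj_le`). With (Int++), each subset thus has a smallest parabolic subgroup
above it, its parabolic closure. A finite subset of `H` whose closure has maximal rank has the same
closure as `H`. It fixes a vertex, so the closure `g A_X g⁻¹` of `H` lies in a vertex stabilizer. If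
`X` contained `v` and `w`, both generators would fix a common vertex. Hence `X` is a clique.

The rank statement rests on an action of the Artin group on pairs of a minimal representative of a
coset of `W_X` in the Coxeter group and an element of `A_X`. A generator `i` either moves the coset,
or fixes it through an `x` in `X` and multiplies the label by `x`. If `g A_Y g⁻¹ ≤ A_X`, following
`g⁻¹` from the base point turns each `y` in `Y` into an element of `X` (`exists_map_conj_eq_of_le`).
The braid relations for this action are checked with roots in the geometric representation. -/

namespace SimpleGraph

/-! ### Geodesics in trees and Serre's lemma -/

variable {W : Type*} {T : SimpleGraph W}

theorem Iso.dist_apply (f : T ≃g T) (hT : T.Connected) (x y : W) :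
    T.dist (f x) (f y) = T.dist x y := by
  have key : ∀ (e : T ≃g T) (a b : W), T.dist (e a) (e b) ≤ T.dist a b := by
    intro e a b
    obtain ⟨p, hp⟩ := hT.exists_walk_length_eq_dist a b
    rw [← hp, ← Walk.length_map e.toHom p]
    exact dist_le _
  refine le_antisymm (key f x y) ?_
  simpa using key f.symm (f x) (f y)

theorem IsTree.length_eq_dist (hT : T.IsTree) {x y : W} {p : T.Walk x y} (hp : p.IsPath) :
    p.length = T.dist x y := by
  obtain ⟨q, hq, hql⟩ := hT.connected.exists_path_of_dist x y
  have : (⟨p, hp⟩ : T.Path x y) = ⟨q, hq⟩ := (hT.isAcyclic.subsingleton_path x y).elim _ _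
  rw [← hql]
  exact congrArg (fun r : T.Path x y => r.1.length) this

/-- In a tree, a point of a geodesic is determined by its distance from one end. -/
theorem IsTree.eq_of_dist_add_dist (hT : T.IsTree) {x y z z' : W}
    (h : T.dist x z + T.dist z y = T.dist x y) (h' : T.dist x z' + T.dist z' y = T.dist x y)
    (hz : T.dist x z = T.dist x z') : z = z' := by
  have key : ∀ a : W, T.dist x a + T.dist a y = T.dist x y →
      ∃ p : T.Path x y, p.1.getVert (T.dist x a) = a := by
    intro a ha
    obtain ⟨p, hp⟩ := hT.connected.exists_walk_length_eq_dist x a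
    obtain ⟨q, hq⟩ := hT.connected.exists_walk_length_eq_dist a y
    refine ⟨⟨p.append q, Walk.isPath_of_length_eq_dist _ ?_⟩, ?_⟩
    · rw [Walk.length_append, hp, hq, ha]
    · simp [Walk.getVert_append, hp]
  obtain ⟨p, hp⟩ := key z h
  obtain ⟨q, hq⟩ := key z' h'
  rw [← hp, ← hq, hz, (hT.isAcyclic.subsingleton_path x y).elim p q]

theorem Connected.exists_adj_dist_add_one (hT : T.Connected) {x p : W} (hne : x ≠ p) :
    ∃ a, T.Adj p a ∧ T.dist x a + 1 = T.dist x p := by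
  obtain ⟨w, hw⟩ := hT.exists_walk_length_eq_dist p x
  cases w with
  | nil => exact absurd rfl hne
  | @cons _ a _ h q =>
    refine ⟨a, h, ?_⟩
    have h1 : T.dist a x ≤ q.length := dist_le q
    have h2 : T.dist p x ≤ T.dist p a + T.dist a x := hT.dist_triangle
    rw [dist_eq_one_iff_adj.mpr h] at h2
    rw [Walk.length_cons] at hw
    rw [dist_comm (u := x), dist_comm (u := x)]
    omega

/-- In a tree, two geodesics which leave a vertex through different edges concatenate to a
geodesic. -/
theorem IsTree.dist_eq_add_of_adj_ne (hT : T.IsTree) {p a b x y : W} (ha : T.Adj p a)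
    (hb : T.Adj p b) (hab : a ≠ b) (hx : T.dist x a + 1 = T.dist x p)
    (hy : T.dist y b + 1 = T.dist y p) : T.dist x y = T.dist x p + T.dist p y := by
  obtain ⟨u, hu⟩ := hT.connected.exists_walk_length_eq_dist a x
  obtain ⟨v, hv⟩ := hT.connected.exists_walk_length_eq_dist b y
  have hP : (Walk.cons ha u).IsPath := Walk.isPath_of_length_eq_dist _ (by
    rw [Walk.length_cons, hu, dist_comm, hx, dist_comm])
  have hQ : (Walk.cons hb v).IsPath := Walk.isPath_of_length_eq_dist _ (by
    rw [Walk.length_cons, hv, dist_comm, hy, dist_comm])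
  -- In a forest a walk without backtracking is a path, so only the two edges meeting at `p` have to
  -- be compared.
  have hR : ((Walk.cons ha u).reverse.append (Walk.cons hb v)).IsPath := by
    rw [hT.isAcyclic.isPath_iff_isChain]
    have h1 := (hT.isAcyclic.isPath_iff_isChain _).mp hP.reverse
    have h2 := (hT.isAcyclic.isPath_iff_isChain _).mp hQ
    simp only [Walk.edges_append, Walk.edges_reverse, Walk.edges_cons, List.reverse_cons,
      List.append_assoc, List.singleton_append] at h1 h2 ⊢
    rw [List.isChain_append_cons_cons]
    refine ⟨h1, ?_, h2⟩
    intro h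
    rw [Sym2.congr_right] at h
    exact hab h
  have := hT.length_eq_dist hR
  rw [Walk.length_append, Walk.length_reverse, Walk.length_cons, Walk.length_cons, hu, hv,
    dist_comm (u := a), dist_comm (u := b), hx, hy] at this
  rw [← this, dist_comm (u := p)]

/-- If an elliptic automorphism of a tree moves `x`, it fixes the midpoint of `x` and its image. -/
theorem IsTree.apply_eq_of_isMidpoint (hT : T.IsTree) (f : T ≃g T) (hf : ∃ y, f y = y) {x z : W}
    (h : T.dist x z + T.dist z (f x) = T.dist x (f x)) (hz : T.dist x z = T.dist z (f x)) :
    f z = z := by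
  classical
  have hex : ∃ n y, f y = y ∧ T.dist x y = n := by
    obtain ⟨y, hy⟩ := hf
    exact ⟨_, y, hy, rfl⟩
  obtain ⟨y, hy, hyn⟩ := Nat.find_spec hex
  have hmin : ∀ y', f y' = y' → T.dist x y ≤ T.dist x y' := fun y' hy' => by
    rw [hyn]
    exact Nat.find_min' hex ⟨y', hy', rfl⟩
  have hyx : T.dist y (f x) = T.dist x y := by
    conv_lhs => rw [← hy]
    rw [f.dist_apply hT.connected, dist_comm]
  -- Since `y` is a fixed vertex nearest to `x`, the neighbour `a` of `y` towards `x` is moved. The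
  -- geodesics from `y` to `x` and to `f x` then leave through the different edges to `a` and `f a`,
  -- so `y` is the midpoint.
  have hadd : T.dist x y + T.dist y (f x) = T.dist x (f x) := by
    by_cases hxy : x = y
    · subst hxy
      simp [hy]
    obtain ⟨a, ha, hda⟩ := hT.connected.exists_adj_dist_add_one hxy
    refine (hT.dist_eq_add_of_adj_ne (b := f a) ha ?_ ?_ hda ?_).symm
    · have := f.map_adj_iff.mpr ha
      rwa [hy] at this
    · intro hfa
      have := hmin a hfa.symm
      omega
    · rw [f.dist_apply hT.connected, hda, dist_comm (u := f x), hyx]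
  have : z = y := hT.eq_of_dist_add_dist h hadd (by omega)
  rw [this, hy]

/-- Serre's lemma: if all elements of a group acting on a tree are elliptic, then finitely many
elements have a common fixed vertex. -/
theorem IsTree.exists_forall_apply_eq (hT : T.IsTree) {G : Type*} [Group G] (ψ : G →* (T ≃g T))
    (hψ : ∀ g, ∃ x, ψ g x = x) (K : Finset G) : ∃ x, ∀ k ∈ K, ψ k x = x := by
  classical
  induction K using Finset.induction_on with
  | empty => exact ⟨(hψ 1).choose, by simp⟩
  | insert h K _ ih =>
    have hex : ∃ n p q, (∀ k ∈ K, ψ k p = p) ∧ ψ h q = q ∧ T.dist q p = n := by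
      obtain ⟨p, hp⟩ := ih
      obtain ⟨q, hq⟩ := hψ h
      exact ⟨_, p, q, hp, hq, rfl⟩
    obtain ⟨p, q, hp, hq, hn⟩ := Nat.find_spec hex
    have hmin : ∀ p' q', (∀ k ∈ K, ψ k p' = p') → ψ h q' = q' → T.dist q p ≤ T.dist q' p' :=
      fun p' q' hp' hq' => by
        rw [hn]
        exact Nat.find_min' hex ⟨p', q', hp', hq', rfl⟩
    by_cases hqp : q = p
    · subst hqp
      exact ⟨q, by simpa [hq] using hp⟩
    exfalso
    obtain ⟨a, ha, hda⟩ := hT.connected.exists_adj_dist_add_one hqp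
    -- If all of `K` fixed `a`, then `a` could replace `p` at a smaller distance from `q`.
    obtain ⟨k, hk, hka⟩ : ∃ k ∈ K, ψ k a ≠ a := by
      by_contra! hcon
      have := hmin a q hcon hq
      omega
    have hkp := hp k hk
    have hdk : T.dist (ψ k q) p = T.dist q p := by
      conv_lhs => rw [← hkp]
      exact (ψ k).dist_apply hT.connected _ _
    have hadd : T.dist q (ψ k q) = T.dist q p + T.dist p (ψ k q) := by
      refine hT.dist_eq_add_of_adj_ne (b := ψ k a) ha ?_ (Ne.symm hka) hda ?_
      · have := (ψ k).map_adj_iff.mpr ha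
        rwa [hkp] at this
      · rw [(ψ k).dist_apply hT.connected, hda, hdk]
    have happ : ψ (k * h) q = ψ k q := by
      rw [map_mul, RelIso.mul_apply, hq]
    -- The elliptic element `k * h` sends `q` to `ψ k q`, and `p` is the midpoint of these two
    -- vertices.
    have hfix : ψ (k * h) p = p := by
      refine hT.apply_eq_of_isMidpoint (x := q) _ (hψ _) ?_ ?_
      · rw [happ, hadd]
      · rw [happ, dist_comm (u := p), hdk]
    have hph : ψ h p = p := by
      rw [map_mul, RelIso.mul_apply] at hfix
      exact (ψ k).injective (hfix.trans hkp.symm)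
    have := hmin p p hp hph
    rw [dist_self] at this
    exact hqp (hT.connected.dist_eq_zero_iff.mp (by omega))

end SimpleGraph

/-! ### The Bass-Serre tree of an amalgamated product of two subgroups -/

namespace BassSerre

open Monoid

variable {G : Type*} [Group G] (Gs : Bool → Subgroup G)

/-- The vertex given by a coset of one of the two factors. -/
def vert (b : Bool) (g : G) : (b : Bool) × (G ⧸ Gs b) := ⟨b, (g : G ⧸ Gs b)⟩

variable {Gs} in
theorem vert_eq_iff {b c : Bool} {g h : G} :
    vert Gs b g = vert Gs c h ↔ b = c ∧ g⁻¹ * h ∈ Gs b := by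
  constructor
  · intro e
    obtain rfl : b = c := congrArg Sigma.fst e
    exact ⟨rfl, QuotientGroup.eq.mp (eq_of_heq (Sigma.mk.inj e).2)⟩
  · rintro ⟨rfl, h⟩
    exact congrArg (Sigma.mk b) (QuotientGroup.eq.mpr h)

theorem exists_vert_eq (x : (b : Bool) × (G ⧸ Gs b)) : ∃ g, x = vert Gs x.1 g := by
  obtain ⟨b, q⟩ := x
  obtain ⟨g, rfl⟩ := QuotientGroup.mk_surjective q
  exact ⟨g, rfl⟩

/-- The coset graph: a coset of one factor is joined to a coset of the other factor if they
intersect. -/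
def cosetGraph : SimpleGraph ((b : Bool) × (G ⧸ Gs b)) where
  Adj x y := ∃ b g, x = vert Gs b g ∧ y = vert Gs (!b) g
  symm := ⟨by
    rintro _ _ ⟨b, g, rfl, rfl⟩
    exact ⟨!b, g, rfl, by rw [Bool.not_not]⟩⟩
  loopless := ⟨by
    rintro _ ⟨b, g, h, h'⟩
    have := (vert_eq_iff.mp (h.symm.trans h')).1
    cases b <;> simp at this⟩

theorem cosetGraph_adj (b : Bool) (g : G) : (cosetGraph Gs).Adj (vert Gs b g) (vert Gs (!b) g) :=
  ⟨b, g, rfl, rfl⟩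

/-- Left translation on the coset graph. -/
def translate (g : G) (x : (b : Bool) × (G ⧸ Gs b)) : (b : Bool) × (G ⧸ Gs b) := ⟨x.1, g • x.2⟩

theorem translate_mul (g h : G) (x) :
    translate Gs (g * h) x = translate Gs g (translate Gs h x) :=
  congrArg (Sigma.mk x.1) (mul_smul g h x.2)

theorem translate_one (x) : translate Gs 1 x = x := by
  simp [translate]

theorem translate_adj (g : G) {x y} (h : (cosetGraph Gs).Adj x y) :
    (cosetGraph Gs).Adj (translate Gs g x) (translate Gs g y) := by
  obtain ⟨b, k, rfl, rfl⟩ := h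
  exact ⟨b, g * k, rfl, rfl⟩

/-- The action of the group on its coset graph. -/
def action : G →* (cosetGraph Gs ≃g cosetGraph Gs) where
  toFun g :=
    { toFun := translate Gs g
      invFun := translate Gs g⁻¹
      left_inv := fun x => by rw [← translate_mul, inv_mul_cancel, translate_one]
      right_inv := fun x => by rw [← translate_mul, mul_inv_cancel, translate_one]
      map_rel_iff' := by
        intro x y
        refine ⟨fun h => ?_, fun h => translate_adj Gs g h⟩
        have := translate_adj Gs g⁻¹ h
        simpa [← translate_mul, translate_one] using this }
  map_one' := by
    ext x : 1
    exact translate_one Gs x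
  map_mul' g h := by
    ext x : 1
    exact translate_mul Gs g h x

@[simp] theorem action_vert (g : G) (b : Bool) (h : G) :
    action Gs g (vert Gs b h) = vert Gs b (g * h) := rfl

variable {Gs} in
theorem action_vert_eq_iff {g h : G} {b : Bool} :
    action Gs g (vert Gs b h) = vert Gs b h ↔ h⁻¹ * g * h ∈ Gs b := by
  rw [eq_comm, action_vert, vert_eq_iff]
  simp [mul_assoc]

theorem connected_cosetGraph (hG : ⨆ b, Gs b = ⊤) : (cosetGraph Gs).Connected := by
  set T := cosetGraph Gs
  have key : ∀ g, T.Reachable (vert Gs true 1) (vert Gs true g) := by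
    intro g
    have hg : g ∈ ⨆ b, Gs b := hG ▸ Subgroup.mem_top g
    induction hg using Subgroup.iSup_induction' with
    | hp b x hx =>
      have h1 : T.Adj (vert Gs true 1) (vert Gs false 1) := cosetGraph_adj Gs true 1
      have h2 : T.Adj (vert Gs true x) (vert Gs false x) := cosetGraph_adj Gs true x
      cases b with
      | false =>
        have : vert Gs false 1 = vert Gs false x := vert_eq_iff.mpr ⟨rfl, by simpa using hx⟩
        rw [← this] at h2
        exact h1.reachable.trans h2.symm.reachable
      | true =>
        have : vert Gs true 1 = vert Gs true x := vert_eq_iff.mpr ⟨rfl, by simpa using hx⟩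
        rw [this]
    | h1 => rfl
    | hmul x y _ _ hx hy =>
      refine hx.trans ?_
      have := hy.map (action Gs x).toHom
      simpa using this
  have : Nonempty ((b : Bool) × (G ⧸ Gs b)) := ⟨vert Gs true 1⟩
  refine SimpleGraph.connected_iff_exists_forall_reachable _ |>.mpr ⟨vert Gs true 1, fun x => ?_⟩
  obtain ⟨g, hg⟩ := exists_vert_eq Gs x
  rw [hg]
  cases x.1 with
  | false => exact (key g).trans (cosetGraph_adj Gs true g).reachable
  | true => exact key g

/-- `IsReducedProd Gs b g` says that `g` is a nonempty product of elements which lie alternately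
in exactly one of the two subgroups, beginning with `Gs b`. -/
inductive IsReducedProd : Bool → G → Prop
  | single (b : Bool) (g : G) : g ∈ Gs b → g ∉ Gs (!b) → IsReducedProd b g
  | cons (b : Bool) (g h : G) : g ∈ Gs b → g ∉ Gs (!b) → IsReducedProd (!b) h →
      IsReducedProd b (g * h)

variable {Gs}

/-- An element of the intersection is absorbed into the first factor without changing which
subgroups contain that factor. -/
theorem IsReducedProd.mul_left {b : Bool} {g k : G} (hg : IsReducedProd Gs b g) (hk : k ∈ Gs b)
    (hk' : k ∈ Gs (!b)) : IsReducedProd Gs b (k * g) := by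
  cases hg with
  | single _ _ h1 h2 =>
    exact .single _ _ (mul_mem hk h1) fun h => h2 ((Subgroup.mul_mem_cancel_left _ hk').mp h)
  | cons _ g h h1 h2 h3 =>
    rw [← mul_assoc]
    exact .cons _ _ _ (mul_mem hk h1) (fun h => h2 ((Subgroup.mul_mem_cancel_left _ hk').mp h)) h3

variable (Gs) in
/-- The inclusions of the intersection of the two subgroups. -/
abbrev baseInclusion (b : Bool) : (⨅ c, Gs c : Subgroup G) →* Gs b :=
  Subgroup.inclusion (iInf_le Gs b)

theorem notMem_range_baseInclusion {b : Bool} {g : Gs b} (h : (g : G) ∉ Gs (!b)) :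
    g ∉ (baseInclusion Gs b).range := by
  rintro ⟨x, rfl⟩
  exact h (Subgroup.mem_iInf.mp x.2 _)

theorem IsReducedProd.exists_word {b : Bool} {g : G} (hg : IsReducedProd Gs b g) :
    ∃ w : CoprodI.Word (fun b => Gs b), w.fstIdx = some b ∧
      PushoutI.Reduced (baseInclusion Gs) w ∧
      CoprodI.lift (fun b => (Gs b).subtype) w.prod = g := by
  have hone : ∀ {b : Bool} {g : G} (h1 : g ∈ Gs b), g ∉ Gs (!b) → (⟨g, h1⟩ : Gs b) ≠ 1 := by
    rintro b g h1 h2 h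
    exact h2 ((Subgroup.mk_eq_one (h := h1)).mp h ▸ one_mem _)
  induction hg with
  | single b g h1 h2 =>
    have he : (CoprodI.Word.empty : CoprodI.Word fun b => Gs b).fstIdx ≠ some b := by
      simp [CoprodI.Word.fstIdx, CoprodI.Word.empty]
    refine ⟨CoprodI.Word.cons ⟨g, h1⟩ .empty he (hone h1 h2), rfl, ?_, by
      rw [CoprodI.Word.prod_cons]; simp⟩
    intro x hx
    simp only [CoprodI.Word.cons, CoprodI.Word.empty, List.mem_singleton] at hx
    subst hx
    exact notMem_range_baseInclusion h2
  | cons b g h h1 h2 _ ih =>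
    obtain ⟨w, hw1, hw2, hw3⟩ := ih
    refine ⟨CoprodI.Word.cons ⟨g, h1⟩ w (by rw [hw1]; simp) (hone h1 h2), rfl, ?_,
      by rw [CoprodI.Word.prod_cons]; simp [hw3]⟩
    intro x hx
    simp only [CoprodI.Word.cons, List.mem_cons] at hx
    rcases hx with rfl | hx
    · exact notMem_range_baseInclusion h2
    · exact hw2 x hx

/-- The normal form theorem in the amalgam: a nonempty reduced word has nontrivial image there. Only
a homomorphism to the amalgam extending the two inclusions is needed, not an isomorphism. -/
theorem IsReducedProd.ne_one {f : G →* PushoutI (baseInclusion Gs)}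
    (hf : ∀ b (g : Gs b), f g = PushoutI.of b g) {b : Bool} {g : G}
    (hg : IsReducedProd Gs b g) : g ≠ 1 := by
  rintro rfl
  obtain ⟨w, hw1, hw2, hw3⟩ := hg.exists_word
  have hcomp : f.comp (CoprodI.lift (fun b => (Gs b).subtype)) = PushoutI.ofCoprodI := by
    refine CoprodI.ext_hom _ _ fun b => ?_
    ext x
    simp [hf]
  have h1 : PushoutI.ofCoprodI w.prod = (1 : PushoutI (baseInclusion Gs)) := by
    rw [← hcomp, MonoidHom.comp_apply, hw3, map_one]
  have := hw2.eq_empty_of_mem_range (fun b => Subgroup.inclusion_injective _)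
    (by rw [h1]; exact one_mem _)
  subst this
  simp [CoprodI.Word.fstIdx, CoprodI.Word.empty] at hw1

/-- Each edge of a path changes the coset representative by an element of the current factor. Not
going back along the previous edge means that this element is outside the other factor, so a path
spells a reduced product. -/
theorem exists_isReducedProd_of_isPath {x y : (b : Bool) × (G ⧸ Gs b)}
    (q : (cosetGraph Gs).Walk x y) (hq : q.IsPath) (b : Bool) (g : G) (hx : x = vert Gs b g)
    (he : s(x, vert Gs (!b) g) ∉ q.edges) :
    y = x ∨ ∃ c r, IsReducedProd Gs b r ∧ y = vert Gs c (g * r) := by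
  induction q generalizing b g with
  | nil => exact .inl rfl
  | @cons x x' y h q ih =>
    right
    obtain ⟨b', k, hk, hk'⟩ := id h
    obtain ⟨rfl, hgk⟩ := vert_eq_iff.mp (hx.symm.trans hk)
    rw [SimpleGraph.Walk.edges_cons, List.mem_cons, not_or] at he
    rw [SimpleGraph.Walk.cons_isPath_iff] at hq
    have hgk' : g⁻¹ * k ∉ Gs (!b) := fun hmem => he.1 (by
      rw [hk', vert_eq_iff.mpr ⟨rfl, hmem⟩])
    rcases ih hq.1 (!b) k hk' (by
      rw [Bool.not_not, ← hk]
      exact fun hmem => hq.2 (q.snd_mem_support_of_mem_edges hmem)) with rfl | ⟨c, r, hr, rfl⟩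
    · exact ⟨!b, g⁻¹ * k, .single _ _ hgk hgk', by rw [hk', mul_inv_cancel_left]⟩
    · exact ⟨c, g⁻¹ * k * r, .cons _ _ _ hgk hgk' hr, by group⟩

/-- The coset graph of an amalgamated product is a tree. -/
theorem isTree_cosetGraph (hG : ⨆ b, Gs b = ⊤) {f : G →* PushoutI (baseInclusion Gs)}
    (hf : ∀ b (g : Gs b), f g = PushoutI.of b g) : (cosetGraph Gs).IsTree := by
  refine ⟨connected_cosetGraph Gs hG, ?_⟩
  intro x p hp
  cases p with
  | nil => exact hp.not_nil (by simp)
  | @cons _ y _ h q =>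
    obtain ⟨hq, he⟩ := SimpleGraph.Walk.cons_isCycle_iff _ _ |>.mp hp
    obtain ⟨b, g, rfl, rfl⟩ := id h
    rcases exists_isReducedProd_of_isPath q hq (!b) g rfl (by
      rwa [Bool.not_not, Sym2.eq_swap]) with hxy | ⟨c, r, hr, hxr⟩
    · exact h.ne hxy
    · obtain ⟨rfl, hmem⟩ := vert_eq_iff.mp hxr
      rw [inv_mul_cancel_left] at hmem
      rw [← inv_mem_iff] at hmem
      -- A cycle closes up with `r` in `Gs b`. Multiplying by `r⁻¹`, either absorbed into the first
      -- factor or as a new first factor, exhibits `1` as a reduced product.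
      by_cases hmem' : r⁻¹ ∈ Gs (!b)
      · exact (hr.mul_left hmem' (by rwa [Bool.not_not])).ne_one hf (inv_mul_cancel r)
      · exact (IsReducedProd.cons _ _ _ hmem hmem' hr).ne_one hf (inv_mul_cancel r)

/-- One end of the base edge is farther from `z` than the other. The element stabilizing the far end
fixes the geodesic from `z` to it, hence also the near end, so it lies in both factors. -/
theorem notMem_of_common_fixedPoint (hT : (cosetGraph Gs).IsTree) {b : Bool} {g h : G}
    (hg : g ∈ Gs b) (hh : h ∈ Gs (!b)) {z} (hgz : action Gs g z = z) (hhz : action Gs h z = z) :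
    g ∈ Gs (!b) ∨ h ∈ Gs b := by
  have key : ∀ (c : Bool) (k : G), k ∈ Gs c → action Gs k z = z →
      (cosetGraph Gs).dist z (vert Gs c 1) = (cosetGraph Gs).dist z (vert Gs (!c) 1) + 1 →
      k ∈ Gs (!c) := by
    intro c k hk hkz hd
    have hadj := cosetGraph_adj Gs c 1
    have h1 : action Gs k (vert Gs c 1) = vert Gs c 1 := action_vert_eq_iff.mpr (by simpa using hk)
    have h2 : action Gs k (vert Gs (!c) 1) = vert Gs (!c) 1 := by
      have hz : (cosetGraph Gs).dist z (action Gs k (vert Gs (!c) 1)) =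
          (cosetGraph Gs).dist z (vert Gs (!c) 1) := by
        conv_lhs => rw [← hkz]
        exact (action Gs k).dist_apply hT.connected _ _
      have hy : (cosetGraph Gs).dist (action Gs k (vert Gs (!c) 1)) (vert Gs c 1) = 1 := by
        rw [SimpleGraph.dist_eq_one_iff_adj]
        have := (action Gs k).map_adj_iff.mpr hadj.symm
        rwa [h1] at this
      refine hT.eq_of_dist_add_dist (x := z) (y := vert Gs c 1) ?_ ?_ hz
      · rw [hz, hy, hd]
      · rw [SimpleGraph.dist_eq_one_iff_adj.mpr hadj.symm, hd]
    simpa using action_vert_eq_iff.mp h2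
  rcases hT.dist_eq_dist_add_one_of_adj z (cosetGraph_adj Gs b 1) with hd | hd
  · exact .inl (key b g hg hgz hd)
  · exact .inr (by simpa using key (!b) h hh hhz (by simpa using hd))

end BassSerre

/-! ### The geometric representation of a Coxeter group -/

namespace CoxeterMatrix

variable {B : Type*} (M : CoxeterMatrix B)

/-- The entries of the Gram matrix of the simple roots. -/
noncomputable def gram (i j : B) : ℝ :=
  if M i j = 0 then -1 else -Real.cos (Real.pi / M i j)

theorem gram_symm (i j : B) : M.gram i j = M.gram j i := by
  unfold gram
  rw [M.symmetric]

@[simp] theorem gram_self (i : B) : M.gram i i = 1 := by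
  simp [gram]

/-- The simple root attached to an index. -/
noncomputable def simpleRoot (i : B) : B →₀ ℝ := Finsupp.single i 1

/-- The bilinear form of the geometric representation. -/
noncomputable def form : (B →₀ ℝ) →ₗ[ℝ] (B →₀ ℝ) →ₗ[ℝ] ℝ :=
  Finsupp.linearCombination ℝ fun i => Finsupp.linearCombination ℝ (M.gram i)

local notation "e" => simpleRoot

@[simp] theorem form_simpleRoot (i j : B) : M.form (e i) (e j) = M.gram i j := by
  simp [form, simpleRoot]

theorem form_symm (x y : B →₀ ℝ) : M.form x y = M.form y x := by
  have : M.form = M.form.flip := by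
    ext i j
    simpa [simpleRoot] using (M.form_simpleRoot i j).trans
      ((M.gram_symm i j).trans (M.form_simpleRoot j i).symm)
  conv_lhs => rw [this]
  rfl

/-- The reflection in a simple root. -/
noncomputable def simpleReflection (i : B) : Module.End ℝ (B →₀ ℝ) :=
  LinearMap.id - (2 • M.form (e i)).smulRight (e i)

local notation "r" => M.simpleReflection

theorem simpleReflection_apply (i : B) (x : B →₀ ℝ) :
    r i x = x - (2 * M.form (e i) x) • e i := by
  simp [simpleReflection]

theorem simpleReflection_simpleRoot (i j : B) :
    r i (e j) = e j - (2 * M.gram i j) • e i := by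
  rw [simpleReflection_apply, form_simpleRoot]

theorem simpleReflection_simpleRoot_self (i : B) : r i (e i) = -e i := by
  rw [simpleReflection_simpleRoot, gram_self]
  module

theorem simpleReflection_simpleReflection (i : B) (x : B →₀ ℝ) : r i (r i x) = x := by
  rw [simpleReflection_apply _ _ x, map_sub, map_smul, simpleReflection_simpleRoot_self,
    simpleReflection_apply]
  module

theorem form_simpleReflection (i : B) (x y : B →₀ ℝ) : M.form (r i x) (r i y) = M.form x y := by
  simp only [simpleReflection_apply, map_sub, map_smul, LinearMap.sub_apply, LinearMap.smul_apply,
    form_simpleRoot, gram_self, smul_eq_mul, M.form_symm x (e i)]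
  ring

theorem simpleReflection_combination_left (i j : B) (a b : ℝ) :
    r i (a • e i + b • e j) = (-a - 2 * M.gram i j * b) • e i + b • e j := by
  rw [map_add, map_smul, map_smul, simpleReflection_simpleRoot_self, simpleReflection_simpleRoot]
  module

theorem simpleReflection_combination_right (i j : B) (a b : ℝ) :
    r j (a • e i + b • e j) = a • e i + (-b - 2 * M.gram i j * a) • e j := by
  rw [add_comm, simpleReflection_combination_left, gram_symm, add_comm]

theorem two_le_of_ne {i j : B} (hij : i ≠ j) (h : M i j ≠ 0) : 2 ≤ M i j := by
  have := M.off_diagonal i j hij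
  omega

theorem sin_pi_div_pos {i j : B} (hij : i ≠ j) (h : M i j ≠ 0) :
    0 < Real.sin (Real.pi / M i j) := by
  have h2 : (2 : ℝ) ≤ M i j := by exact_mod_cast M.two_le_of_ne hij h
  apply Real.sin_pos_of_pos_of_lt_pi
  · have := Real.pi_pos
    positivity
  · exact div_lt_self Real.pi_pos (by linarith)

theorem gram_of_ne_zero {i j : B} (h : M i j ≠ 0) : M.gram i j = -Real.cos (Real.pi / M i j) :=
  if_neg h

/-- For a finite label, the product of two reflections rotates the plane of the two simple roots by
twice `π / M i j` and is trivial on the orthogonal complement. The form is nondegenerate on the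
plane, so the two pieces span everything. -/
theorem isLiftable_simpleReflection : M.IsLiftable M.simpleReflection := by
  suffices H : ∀ i j, i ≠ j → M i j ≠ 0 → (r j * r i) ^ M i j = 1 by
    intro i j
    by_cases hij : i = j
    · subst hij
      rw [M.diagonal, pow_one]
      refine LinearMap.ext fun y => ?_
      rw [Module.End.mul_apply, simpleReflection_simpleReflection, Module.End.one_apply]
    by_cases h : M i j = 0
    · rw [h, pow_zero]
    · rw [M.symmetric] at h ⊢
      exact H j i (Ne.symm hij) h
  intro i j hij h
  set θ := Real.pi / M i j with hθ
  have hs : Real.sin θ ≠ 0 := (M.sin_pi_div_pos hij h).ne'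
  have hg : M.gram i j = -Real.cos θ := M.gram_of_ne_zero h
  have hmθ : (M i j : ℝ) * θ = Real.pi := by
    rw [hθ]
    field_simp
  -- The vectors `sin (φ + θ) • e i + sin φ • e j` parametrize an ellipse in the plane on which the
  -- rotation is a shift of `φ`.
  have hstep : ∀ φ : ℝ, (r j * r i) (Real.sin (φ + θ) • e i + Real.sin φ • e j) =
      Real.sin (φ - 2 * θ + θ) • e i + Real.sin (φ - 2 * θ) • e j := by
    intro φ
    rw [Module.End.mul_apply, simpleReflection_combination_left,
      simpleReflection_combination_right, hg]
    have h1 : -Real.sin (φ + θ) - 2 * -Real.cos θ * Real.sin φ = Real.sin (φ - 2 * θ + θ) := by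
      rw [show φ - 2 * θ + θ = φ - θ by ring, Real.sin_add, Real.sin_sub]
      ring
    have h2 : -Real.sin φ - 2 * -Real.cos θ * Real.sin (φ - 2 * θ + θ) =
        Real.sin (φ - 2 * θ) := by
      rw [show φ - 2 * θ = (φ - θ) - θ by ring, Real.sin_sub (φ - θ), sub_add_cancel]
      nth_rewrite 1 [show φ = (φ - θ) + θ by ring]
      rw [Real.sin_add (φ - θ)]
      ring
    rw [h1, h2]
  have hpow : ∀ (n : ℕ) (φ : ℝ),
      ((r j * r i) ^ n) (Real.sin (φ + θ) • e i + Real.sin φ • e j) =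
      Real.sin (φ - 2 * (n * θ) + θ) • e i + Real.sin (φ - 2 * (n * θ)) • e j := by
    intro n
    induction n with
    | zero => simp
    | succ n ih =>
      intro φ
      rw [pow_succ, Module.End.mul_apply, hstep, ih]
      push_cast
      ring_nf
  have hfix : ∀ φ : ℝ, ((r j * r i) ^ M i j) (Real.sin (φ + θ) • e i + Real.sin φ • e j) =
      Real.sin (φ + θ) • e i + Real.sin φ • e j := by
    intro φ
    rw [hpow, hmθ, show φ - 2 * Real.pi + θ = φ + θ - 2 * Real.pi by ring, Real.sin_sub_two_pi,
      Real.sin_sub_two_pi]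
  have hi : ((r j * r i) ^ M i j) (e i) = e i := by
    have := hfix 0
    simp only [zero_add, Real.sin_zero, zero_smul, add_zero, map_smul] at this
    exact smul_right_injective _ hs this
  have hj : ((r j * r i) ^ M i j) (e j) = e j := by
    have := hfix (-θ)
    simp only [neg_add_cancel, Real.sin_zero, zero_smul, zero_add, map_smul] at this
    exact smul_right_injective _ (by rw [Real.sin_neg]; exact neg_ne_zero.mpr hs) this
  refine LinearMap.ext fun z => ?_
  set a := M.form (e i) z with ha
  set c := M.form (e j) z with hc
  -- This is the orthogonal projection of `z` to the plane, found by inverting the 2 by 2 Gram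
  -- matrix of determinant `sin θ ^ 2`.
  set p := ((a + Real.cos θ * c) / Real.sin θ ^ 2) • e i +
    ((c + Real.cos θ * a) / Real.sin θ ^ 2) • e j with hp
  have hss : Real.sin θ ^ 2 ≠ 0 := pow_ne_zero 2 hs
  have hcs : Real.cos θ ^ 2 = 1 - Real.sin θ ^ 2 := Real.cos_sq' θ
  have h1 : r i (z - p) = z - p := by
    have : M.form (e i) (z - p) = 0 := by
      rw [hp]
      simp only [map_sub, map_add, map_smul, form_simpleRoot, gram_self, hg, ← ha, smul_eq_mul]
      field_simp
      linear_combination a * hcs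
    rw [simpleReflection_apply, this]
    simp
  have h2 : r j (z - p) = z - p := by
    have : M.form (e j) (z - p) = 0 := by
      rw [hp]
      simp only [map_sub, map_add, map_smul, form_simpleRoot, gram_self, M.gram_symm j i, hg, ← hc,
        smul_eq_mul]
      field_simp
      linear_combination c * hcs
    rw [simpleReflection_apply, this]
    simp
  have h3 : ∀ n : ℕ, ((r j * r i) ^ n) (z - p) = z - p := by
    intro n
    induction n with
    | zero => simp
    | succ n ih => rw [pow_succ, Module.End.mul_apply, Module.End.mul_apply, h1, h2, ih]
  have h4 : ((r j * r i) ^ M i j) p = p := by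
    rw [hp, map_add, map_smul, map_smul, hi, hj]
  calc ((r j * r i) ^ M i j) z = ((r j * r i) ^ M i j) ((z - p) + p) := by rw [sub_add_cancel]
    _ = z := by rw [map_add, h3, h4, sub_add_cancel]

/-- The geometric representation. -/
noncomputable def geomRep : M.Group →* Module.End ℝ (B →₀ ℝ) :=
  M.toCoxeterSystem.lift ⟨_, M.isLiftable_simpleReflection⟩

local notation "ρ" => M.geomRep

theorem geomRep_simple (i : B) : ρ (M.toCoxeterSystem.simple i) = r i :=
  M.toCoxeterSystem.lift_apply_simple M.isLiftable_simpleReflection i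

theorem form_geomRep (w : M.Group) (x y : B →₀ ℝ) : M.form (ρ w x) (ρ w y) = M.form x y := by
  induction w using M.toCoxeterSystem.simple_induction_left with
  | one => simp
  | mul_simple_left w i ih =>
    rw [map_mul, geomRep_simple, Module.End.mul_apply, Module.End.mul_apply, form_simpleReflection,
      ih]

theorem geomRep_inv_apply_apply (w : M.Group) (x : B →₀ ℝ) : ρ w⁻¹ (ρ w x) = x := by
  rw [← Module.End.mul_apply, ← map_mul, inv_mul_cancel, map_one, Module.End.one_apply]

theorem geomRep_apply_inv_apply (w : M.Group) (x : B →₀ ℝ) : ρ w (ρ w⁻¹ x) = x := by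
  rw [← Module.End.mul_apply, ← map_mul, mul_inv_cancel, map_one, Module.End.one_apply]

/-- The coefficients of the roots of a dihedral group with respect to the simple roots. -/
noncomputable def dihedralCoeff (κ : ℝ) : ℕ → ℝ
  | 0 => 0
  | 1 => 1
  | n + 2 => 2 * κ * dihedralCoeff κ (n + 1) - dihedralCoeff κ n

theorem dihedralCoeff_one (n : ℕ) : dihedralCoeff 1 n = n := by
  induction n using Nat.twoStepInduction with
  | zero => simp [dihedralCoeff]
  | one => simp [dihedralCoeff]
  | more n h1 h2 =>
    rw [dihedralCoeff, h1, h2]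
    push_cast
    ring

/-- The recursion is that of the Chebyshev polynomials of the second kind, which makes the sign of
the coefficients visible. -/
theorem sin_mul_dihedralCoeff (θ : ℝ) (n : ℕ) :
    Real.sin θ * dihedralCoeff (Real.cos θ) n = Real.sin (n * θ) := by
  induction n using Nat.twoStepInduction with
  | zero => simp [dihedralCoeff]
  | one => simp [dihedralCoeff]
  | more n h1 h2 =>
    rw [dihedralCoeff, mul_sub, h1, show Real.sin θ * (2 * Real.cos θ *
      dihedralCoeff (Real.cos θ) (n + 1)) = 2 * Real.cos θ * (Real.sin θ *
      dihedralCoeff (Real.cos θ) (n + 1)) by ring, h2]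
    push_cast
    rw [show ((n : ℝ) + 2) * θ = (n + 1) * θ + θ by ring,
      show (n : ℝ) * θ = (n + 1) * θ - θ by ring, Real.sin_add, Real.sin_sub]
    ring

theorem dihedralCoeff_pos {i j : B} (hij : i ≠ j) {k : ℕ} (hk : 0 < k)
    (h : M i j ≠ 0 → k < M i j) : 0 < dihedralCoeff (-M.gram i j) k := by
  by_cases h0 : M i j = 0
  · rw [gram, if_pos h0, neg_neg, dihedralCoeff_one]
    exact_mod_cast hk
  · have h1 := M.sin_pi_div_pos hij h0
    have h2 := sin_mul_dihedralCoeff (Real.pi / M i j) k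
    rw [M.gram_of_ne_zero h0, neg_neg]
    have hm : (0 : ℝ) < M i j := by exact_mod_cast Nat.pos_of_ne_zero h0
    have hkm : (k : ℝ) < M i j := by exact_mod_cast h h0
    have hk0 : (0 : ℝ) < k := by exact_mod_cast hk
    have h3 : 0 < Real.sin (k * (Real.pi / M i j)) := by
      apply Real.sin_pos_of_pos_of_lt_pi
      · have := Real.pi_pos
        positivity
      · rw [mul_div_assoc', div_lt_iff₀ hm, mul_comm]
        exact mul_lt_mul_of_pos_left hkm Real.pi_pos
    rw [← h2] at h3
    exact (pos_iff_pos_of_mul_pos h3).mp h1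

theorem dihedralCoeff_eq_zero {i j : B} (hij : i ≠ j) (h : M i j ≠ 0) :
    dihedralCoeff (-M.gram i j) (M i j) = 0 := by
  have h1 := M.sin_pi_div_pos hij h
  have h2 := sin_mul_dihedralCoeff (Real.pi / M i j) (M i j)
  rw [mul_div_cancel₀ _ (by exact_mod_cast h), Real.sin_pi] at h2
  rw [M.gram_of_ne_zero h, neg_neg]
  exact (mul_eq_zero.mp h2).resolve_left h1.ne'

theorem dihedralCoeff_succ {i j : B} (hij : i ≠ j) (h : M i j ≠ 0) :
    dihedralCoeff (-M.gram i j) (M i j + 1) = -1 := by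
  have h1 := M.sin_pi_div_pos hij h
  have h2 := sin_mul_dihedralCoeff (Real.pi / M i j) (M i j + 1)
  push_cast at h2
  rw [add_one_mul, mul_div_cancel₀ _ (by exact_mod_cast h), add_comm Real.pi, Real.sin_add_pi] at h2
  rw [M.gram_of_ne_zero h, neg_neg]
  apply mul_left_cancel₀ h1.ne'
  rw [h2]
  ring

theorem dihedralCoeff_nonneg {i j : B} (hij : i ≠ j) {k : ℕ} (h : M i j ≠ 0 → k ≤ M i j) :
    0 ≤ dihedralCoeff (-M.gram i j) k := by
  rcases Nat.eq_zero_or_pos k with rfl | hk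
  · exact le_rfl
  by_cases hkm : M i j ≠ 0 ∧ k = M i j
  · rw [hkm.2, M.dihedralCoeff_eq_zero hij hkm.1]
  · refine (M.dihedralCoeff_pos hij hk fun h0 => ?_).le
    have := h h0
    omega

open CoxeterSystem

/-- The word acts first by its last letter `j`, then alternately by `i` and `j`. Each letter
replaces the older of two consecutive coefficients by the next one. -/
theorem geomRep_alternatingWord (i j : B) (k : ℕ) :
    ρ (M.toCoxeterSystem.wordProd (alternatingWord i j k)) (e i) =
      if Even k then
        dihedralCoeff (-M.gram i j) (k + 1) • e i + dihedralCoeff (-M.gram i j) k • e j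
      else dihedralCoeff (-M.gram i j) k • e i + dihedralCoeff (-M.gram i j) (k + 1) • e j := by
  induction k with
  | zero => simp [alternatingWord, dihedralCoeff]
  | succ k ih =>
    rw [alternatingWord_succ', wordProd_cons, map_mul, Module.End.mul_apply, ih, geomRep_simple]
    by_cases hk : Even k
    · rw [if_pos hk, if_pos hk, if_neg (by simpa [Nat.even_add_one] using hk),
        simpleReflection_combination_right, dihedralCoeff]
      ring_nf
    · rw [if_neg hk, if_neg hk, if_pos (by simpa [Nat.even_add_one] using hk),
        simpleReflection_combination_left, dihedralCoeff]
      ring_nf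

theorem simpleRoot_nonneg (i : B) : 0 ≤ (e i : B →₀ ℝ) := by
  rw [simpleRoot, Finsupp.single_nonneg]
  exact zero_le_one

theorem geomRep_alternatingWord_nonneg {i j : B} (hij : i ≠ j) {k : ℕ}
    (h : M i j ≠ 0 → k < M i j) : ∃ a b : ℝ, 0 ≤ a ∧ 0 ≤ b ∧
      ρ (M.toCoxeterSystem.wordProd (alternatingWord i j k)) (e i) = a • e i + b • e j := by
  have h1 : 0 ≤ dihedralCoeff (-M.gram i j) (k + 1) := M.dihedralCoeff_nonneg hij h
  have h2 : 0 ≤ dihedralCoeff (-M.gram i j) k := M.dihedralCoeff_nonneg hij fun h0 => (h h0).le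
  rw [geomRep_alternatingWord]
  split_ifs
  · exact ⟨_, _, h1, h2, rfl⟩
  · exact ⟨_, _, h2, h1, rfl⟩

/-- The action on a simple root is positive as long as the length increases. -/
theorem geomRep_simpleRoot_nonneg (w : M.Group) (i : B)
    (h : ¬ M.toCoxeterSystem.IsRightDescent w i) :
    0 ≤ ρ w (e i) := by
  induction hn : M.toCoxeterSystem.length w using Nat.strong_induction_on generalizing w i with
  | _ n ih =>
    subst hn
    by_cases hw : w = 1
    · subst hw
      simpa using simpleRoot_nonneg i
    obtain ⟨j, hj⟩ := M.toCoxeterSystem.exists_rightDescent_of_ne_one hw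
    have hij : i ≠ j := by
      rintro rfl
      exact h hj
    -- Split off from `w` the longest possible alternating tail in `i` and `j` with additive
    -- lengths. The remaining `v` is shorter, so induction applies to it.
    let P : ℕ → Prop := fun k =>
      ∃ v, w = v * M.toCoxeterSystem.wordProd (alternatingWord i j k) ∧
        M.toCoxeterSystem.length v + k = M.toCoxeterSystem.length w
    have hP1 : P 1 := ⟨w * M.toCoxeterSystem.simple j, by
      rw [show alternatingWord i j 1 = [j] from rfl, wordProd_singleton,
        simple_mul_simple_cancel_right],
      M.toCoxeterSystem.isRightDescent_iff.mp hj⟩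
    classical
    have hle : 1 ≤ M.toCoxeterSystem.length w := by
      obtain ⟨v, -, hv⟩ := hP1
      omega
    set k := Nat.findGreatest P (M.toCoxeterSystem.length w) with hk
    have hPk : P k := Nat.findGreatest_spec hle hP1
    have hk1 : 1 ≤ k := Nat.le_findGreatest hle hP1
    obtain ⟨v, hv, hlv⟩ := hPk
    have hmax : ¬ P (k + 1) := by
      intro hcon
      have hle' : k + 1 ≤ M.toCoxeterSystem.length w := by
        obtain ⟨v', -, hv'⟩ := hcon
        omega
      have := Nat.le_findGreatest hle' hcon
      omega
    have hnext : ¬ M.toCoxeterSystem.IsRightDescent v (if Even k then j else i) := by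
      intro hd
      refine hmax ⟨v * M.toCoxeterSystem.simple (if Even k then j else i), ?_, ?_⟩
      · rw [alternatingWord_succ', wordProd_cons, hv, mul_assoc, simple_mul_simple_cancel_left]
      · have := M.toCoxeterSystem.isRightDescent_iff.mp hd
        omega
    clear_value k
    obtain ⟨l, rfl⟩ : ∃ l, k = l + 1 := ⟨k - 1, by omega⟩
    -- If `v` could end in the first letter of the tail, the two letters would cancel and `w` would
    -- be shorter than its length.
    have hprev : ¬ M.toCoxeterSystem.IsRightDescent v (if Even l then j else i) := by
      intro hd
      have h1 := M.toCoxeterSystem.isRightDescent_iff.mp hd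
      have h2 : w = v * M.toCoxeterSystem.simple (if Even l then j else i) *
          M.toCoxeterSystem.wordProd (alternatingWord i j l) := by
        rw [hv, alternatingWord_succ', wordProd_cons, mul_assoc]
      have h3 := M.toCoxeterSystem.length_mul_le
        (v * M.toCoxeterSystem.simple (if Even l then j else i))
        (M.toCoxeterSystem.wordProd (alternatingWord i j l))
      have h4 := M.toCoxeterSystem.length_wordProd_le (alternatingWord i j l)
      rw [← h2] at h3
      rw [length_alternatingWord] at h4
      omega
    have hvi : 0 ≤ ρ v (e i) := by
      refine ih _ (by omega) v i ?_ rfl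
      by_cases hl : Even l
      · rwa [if_neg (by simpa [Nat.even_add_one] using hl)] at hnext
      · rwa [if_neg hl] at hprev
    have hvj : 0 ≤ ρ v (e j) := by
      refine ih _ (by omega) v j ?_ rfl
      by_cases hl : Even l
      · rwa [if_pos hl] at hprev
      · rwa [if_pos (by simpa [Nat.even_add_one] using hl)] at hnext
    -- Otherwise the tail extended by `i` has more than `M i j` letters and is not reduced, so `i`
    -- would be a right descent of `w`.
    have hbound : M i j ≠ 0 → l + 1 < M i j := by
      intro h0
      by_contra hcon
      have h1 := M.toCoxeterSystem.not_isRightDescent_iff.mp h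
      have h2 : w * M.toCoxeterSystem.simple i =
          v * M.toCoxeterSystem.wordProd (alternatingWord j i (l + 1 + 1)) := by
        rw [alternatingWord_succ, List.concat_eq_append, wordProd_append, wordProd_singleton, hv,
          mul_assoc]
      have h3 := M.toCoxeterSystem.length_mul_le v
        (M.toCoxeterSystem.wordProd (alternatingWord j i (l + 1 + 1)))
      have h4 := M.toCoxeterSystem.length_wordProd_le (alternatingWord j i (l + 1 + 1))
      have h5 : ¬ M.toCoxeterSystem.IsReduced (alternatingWord j i (l + 1 + 1)) :=
        M.toCoxeterSystem.not_isReduced_alternatingWord _ _ (by rwa [M.symmetric]) (by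
          rw [M.symmetric]
          omega)
      rw [CoxeterSystem.IsReduced] at h5
      rw [← h2] at h3
      rw [length_alternatingWord] at h4 h5
      omega
    obtain ⟨a, b, ha, hb, hab⟩ := M.geomRep_alternatingWord_nonneg hij hbound
    rw [hv, map_mul, Module.End.mul_apply, hab, map_add, map_smul, map_smul]
    exact add_nonneg (smul_nonneg ha hvi) (smul_nonneg hb hvj)

theorem geomRep_simpleRoot_nonpos (w : M.Group) (i : B) (h : M.toCoxeterSystem.IsRightDescent w i) :
    ρ w (e i) ≤ 0 := by
  have := M.geomRep_simpleRoot_nonneg (w * M.toCoxeterSystem.simple i) i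
    (M.toCoxeterSystem.isRightDescent_iff_not_isRightDescent_mul.mp h)
  rw [map_mul, Module.End.mul_apply, geomRep_simple, simpleReflection_simpleRoot_self, map_neg]
    at this
  exact neg_nonneg.mp this

theorem geomRep_simpleRoot_nonneg_or_nonpos (w : M.Group) (i : B) :
    0 ≤ ρ w (e i) ∨ ρ w (e i) ≤ 0 := by
  by_cases h : M.toCoxeterSystem.IsRightDescent w i
  · exact .inr (M.geomRep_simpleRoot_nonpos w i h)
  · exact .inl (M.geomRep_simpleRoot_nonneg w i h)

theorem simpleRoot_apply_self (i : B) : (e i : B →₀ ℝ) i = 1 := by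
  simp [simpleRoot]

theorem simpleRoot_apply_of_ne {i j : B} (h : i ≠ j) : (e i : B →₀ ℝ) j = 0 := by
  rw [simpleRoot, Finsupp.single_eq_of_ne' h]

theorem simpleRoot_not_nonpos (i : B) : ¬ (e i : B →₀ ℝ) ≤ 0 := by
  intro h
  have := h i
  rw [simpleRoot_apply_self, Finsupp.zero_apply] at this
  linarith

/-- The geometric representation is faithful. -/
theorem geomRep_injective : Function.Injective ρ := by
  have key : ∀ w, ρ w = 1 → w = 1 := by
    intro w hw
    by_contra hne
    obtain ⟨j, hj⟩ := M.toCoxeterSystem.exists_rightDescent_of_ne_one hne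
    have := M.geomRep_simpleRoot_nonpos w j hj
    rw [hw, Module.End.one_apply] at this
    exact simpleRoot_not_nonpos j this
  intro w w' h
  have : ρ (w⁻¹ * w') = 1 := by
    rw [map_mul, ← h, ← map_mul, inv_mul_cancel, map_one]
  exact inv_mul_eq_one.mp (key _ this)

/-- An element which maps one simple root to another one intertwines the reflections. -/
theorem simple_mul_eq_mul_simple {w : M.Group} {i j : B} (h : ρ w (e i) = e j) :
    M.toCoxeterSystem.simple j * w = w * M.toCoxeterSystem.simple i := by
  apply M.geomRep_injective
  refine LinearMap.ext fun x => ?_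
  rw [map_mul, map_mul, Module.End.mul_apply, Module.End.mul_apply, geomRep_simple, geomRep_simple,
    simpleReflection_apply, simpleReflection_apply, map_sub, map_smul, h, ← h, form_geomRep]

/-- A simple reflection preserves positivity of the roots other than its own simple root. -/
theorem geomRep_simple_mul_nonneg {w : M.Group} {i j : B} (h : 0 ≤ ρ w (e i))
    (hne : ρ w (e i) ≠ e j) : 0 ≤ ρ (M.toCoxeterSystem.simple j * w) (e i) := by
  rcases M.geomRep_simpleRoot_nonneg_or_nonpos (M.toCoxeterSystem.simple j * w) i with h' | h'
  · exact h'
  exfalso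
  rw [map_mul, Module.End.mul_apply, geomRep_simple, simpleReflection_apply] at h'
  -- The reflection changes only coordinate `j`. A root whose sign it reverses is therefore
  -- supported at `j`, and invariance of the form makes it the simple root.
  have hcoord : ∀ l, j ≠ l → ρ w (e i) l = 0 := by
    intro l hl
    have h1 := h' l
    have h2 := h l
    rw [Finsupp.sub_apply, Finsupp.smul_apply, simpleRoot_apply_of_ne hl] at h1
    simp only [smul_zero, sub_zero, Finsupp.zero_apply] at h1 h2
    exact le_antisymm h1 h2
  have heq : ρ w (e i) = (ρ w (e i) j) • e j := by
    ext l
    by_cases hl : j = l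
    · subst hl
      simp [simpleRoot_apply_self]
    · rw [hcoord l hl, Finsupp.smul_apply, simpleRoot_apply_of_ne hl, smul_zero]
  have hnorm := M.form_geomRep w (e i) (e i)
  rw [heq] at hnorm
  simp only [map_smul, LinearMap.smul_apply, form_simpleRoot, gram_self, smul_eq_mul,
    mul_one] at hnorm
  have hpos : 0 ≤ ρ w (e i) j := h j
  have : ρ w (e i) j = 1 := by nlinarith
  rw [this, one_smul] at heq
  exact hne heq

theorem geomRep_simpleRoot_ne_neg {w : M.Group} {i j : B} (h : 0 ≤ ρ w (e i)) :
    ρ w (e i) ≠ -e j := by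
  intro h'
  rw [h', neg_nonneg] at h
  exact simpleRoot_not_nonpos j h

end CoxeterMatrix

/-! ### The labelled action of an Artin group on minimal coset representatives -/

namespace CoxeterSystem

variable {B : Type*}

theorem alternatingWord_add (i j : B) (p q : ℕ) :
    alternatingWord i j (p + q) =
      (if Even q then alternatingWord i j p else alternatingWord j i p) ++
        alternatingWord i j q := by
  induction q generalizing i j with
  | zero => simp [alternatingWord]
  | succ q ih =>
    rw [← add_assoc, alternatingWord_succ, ih, alternatingWord_succ]
    by_cases hq : Even q
    · rw [if_pos hq, if_neg (by simpa [Nat.even_add_one] using hq)]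
      simp
    · rw [if_neg hq, if_pos (by simpa [Nat.even_add_one] using hq)]
      simp

end CoxeterSystem

namespace CoxeterMatrix

open CoxeterSystem

variable {B : Type*} (M : CoxeterMatrix B)

local notation "e" => simpleRoot
local notation "ρ" => M.geomRep
local notation "π" => M.toCoxeterSystem.wordProd

theorem simpleRoot_injective : Function.Injective (simpleRoot : B → B →₀ ℝ) :=
  Finsupp.single_left_injective one_ne_zero

theorem geomRep_apply_injective (w : M.Group) : Function.Injective (ρ w) :=
  Function.LeftInverse.injective (M.geomRep_inv_apply_apply w)

/-- The span of two simple roots. -/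
noncomputable def rootPlane (i j : B) : Submodule ℝ (B →₀ ℝ) := Submodule.span ℝ {e i, e j}

theorem mem_rootPlane {i j : B} {x : B →₀ ℝ} :
    x ∈ rootPlane i j ↔ ∃ a b : ℝ, a • e i + b • e j = x :=
  Submodule.mem_span_pair

theorem rootPlane_comm (i j : B) : rootPlane i j = rootPlane j i := by
  rw [rootPlane, rootPlane, Set.pair_comm]

theorem left_mem_rootPlane (i j : B) : e i ∈ rootPlane i j :=
  Submodule.subset_span (by simp)

theorem right_mem_rootPlane (i j : B) : e j ∈ rootPlane i j :=
  Submodule.subset_span (by simp)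

theorem simpleReflection_mem_iff {S : Submodule ℝ (B →₀ ℝ)} {i : B} (hi : e i ∈ S)
    {x : B →₀ ℝ} : M.simpleReflection i x ∈ S ↔ x ∈ S := by
  rw [simpleReflection_apply, sub_eq_add_neg]
  exact Submodule.add_mem_iff_left _ (S.neg_mem (S.smul_mem _ hi))

theorem geomRep_alternatingWord_mem_iff {i j : B} {k : ℕ} {x : B →₀ ℝ} :
    ρ (π (alternatingWord i j k)) x ∈ rootPlane i j ↔ x ∈ rootPlane i j := by
  induction k with
  | zero => simp [alternatingWord]
  | succ k ih =>
    rw [alternatingWord_succ', wordProd_cons, map_mul, Module.End.mul_apply, geomRep_simple,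
      simpleReflection_mem_iff, ih]
    split_ifs
    · exact right_mem_rootPlane i j
    · exact left_mem_rootPlane i j

theorem combination_nonneg {i j : B} (hij : i ≠ j) {a b : ℝ}
    (h : 0 ≤ a • e i + b • (e j : B →₀ ℝ)) : 0 ≤ a ∧ 0 ≤ b := by
  have h1 := h i
  have h2 := h j
  simp only [Finsupp.add_apply, Finsupp.smul_apply, simpleRoot_apply_self,
    simpleRoot_apply_of_ne hij, simpleRoot_apply_of_ne hij.symm, Finsupp.zero_apply,
    smul_eq_mul] at h1 h2
  constructor <;> linarith

theorem eq_simpleRoot_of_eq_smul {w : M.Group} {x i : B} (h : 0 ≤ ρ w (e x)) {a : ℝ}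
    (ha : ρ w (e x) = a • e i) : ρ w (e x) = e i := by
  have hnorm := M.form_geomRep w (e x) (e x)
  have hpos := h i
  rw [ha] at hnorm hpos
  simp only [map_smul, LinearMap.smul_apply, form_simpleRoot, gram_self, smul_eq_mul, mul_one,
    Finsupp.smul_apply, simpleRoot_apply_self, Finsupp.zero_apply] at hnorm hpos
  have : a = 1 := by nlinarith
  rw [ha, this, one_smul]

/-- Two positive images of simple roots which lie in the plane of two simple roots are these simple
roots. -/
theorem eq_simpleRoots_of_mem_rootPlane {w : M.Group} {i j x y : B} (hij : i ≠ j) (hxy : x ≠ y)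
    (hx : 0 ≤ ρ w (e x)) (hy : 0 ≤ ρ w (e y)) (hxm : ρ w (e x) ∈ rootPlane i j)
    (hym : ρ w (e y) ∈ rootPlane i j) :
    (ρ w (e x) = e i ∧ ρ w (e y) = e j) ∨ (ρ w (e x) = e j ∧ ρ w (e y) = e i) := by
  obtain ⟨p₁, q₁, h₁⟩ := mem_rootPlane.mp hxm
  obtain ⟨p₂, q₂, h₂⟩ := mem_rootPlane.mp hym
  obtain ⟨hp₁, hq₁⟩ := combination_nonneg hij (h₁ ▸ hx)
  obtain ⟨hp₂, hq₂⟩ := combination_nonneg hij (h₂ ▸ hy)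
  -- Cramer's rule expresses `D • e i` and `D • e j` as images of differences of nonnegative
  -- multiples of `e x` and `e y`.
  set D := p₁ * q₂ - p₂ * q₁ with hD
  have hDi : ρ w (q₂ • e x - q₁ • e y) = D • e i := by
    rw [map_sub, map_smul, map_smul, ← h₁, ← h₂, hD]
    module
  have hDj : ρ w (p₁ • e y - p₂ • e x) = D • e j := by
    rw [map_sub, map_smul, map_smul, ← h₁, ← h₂, hD]
    module
  have hcoord : ∀ (a b : ℝ), (a • e x - b • (e y : B →₀ ℝ)) x = a ∧
      (a • e x - b • (e y : B →₀ ℝ)) y = -b := by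
    intro a b
    simp [simpleRoot_apply_self, simpleRoot_apply_of_ne hxy, simpleRoot_apply_of_ne hxy.symm]
  have hD0 : D ≠ 0 := by
    intro h0
    rw [h0, zero_smul] at hDi hDj
    have hi := M.geomRep_apply_injective w (hDi.trans (map_zero _).symm)
    have hj := M.geomRep_apply_injective w (hDj.trans (map_zero _).symm)
    have hq := (hcoord q₂ q₁).2
    have hp := congrArg (· y) hj
    rw [hi] at hq
    simp [simpleRoot_apply_self, simpleRoot_apply_of_ne hxy] at hq hp
    rw [hq, hp] at h₁
    simp only [zero_smul, add_zero] at h₁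
    have := M.geomRep_apply_injective w (h₁.symm.trans (map_zero _).symm)
    exact simpleRoot_not_nonpos x this.le
  -- The preimage of a simple root is a root, so its coordinates at `x` and `y` cannot have opposite
  -- signs.
  have hsign : ∀ (l : B) (a b c : ℝ), 0 ≤ a → 0 ≤ b →
      ρ w (a • e x - b • e y) = c • e l → a = 0 ∨ b = 0 := by
    intro l a b c ha hb h
    have h' : a • e x - b • e y = c • ρ w⁻¹ (e l) := by
      rw [← map_smul, ← h, geomRep_inv_apply_apply]
    obtain ⟨hcx, hcy⟩ := hcoord a b
    rw [h'] at hcx hcy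
    simp only [Finsupp.smul_apply, smul_eq_mul] at hcx hcy
    have hprod : 0 ≤ (ρ w⁻¹ (e l)) x * (ρ w⁻¹ (e l)) y := by
      rcases M.geomRep_simpleRoot_nonneg_or_nonpos w⁻¹ l with hs | hs
      · exact mul_nonneg (hs x) (hs y)
      · exact mul_nonneg_of_nonpos_of_nonpos (hs x) (hs y)
    have h1 : a * (-b) = c ^ 2 * ((ρ w⁻¹ (e l)) x * (ρ w⁻¹ (e l)) y) := by
      rw [← hcx, ← hcy]
      ring
    have h2 : 0 ≤ c ^ 2 * ((ρ w⁻¹ (e l)) x * (ρ w⁻¹ (e l)) y) := by positivity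
    have h3 : a * b = 0 := le_antisymm (by linarith) (mul_nonneg ha hb)
    exact mul_eq_zero.mp h3
  have hq := hsign i q₂ q₁ D hq₂ hq₁ hDi
  have hp := hsign j p₂ p₁ (-D) hp₂ hp₁ (by
    rw [neg_smul, ← hDj, ← map_neg, neg_sub])
  rcases hq with rfl | rfl <;> rcases hp with rfl | rfl
  · simp [hD] at hD0
  · refine .inr ⟨M.eq_simpleRoot_of_eq_smul hx (a := q₁) ?_,
      M.eq_simpleRoot_of_eq_smul hy (a := p₂) ?_⟩
    · rw [← h₁, zero_smul, zero_add]
    · rw [← h₂, zero_smul, add_zero]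
  · refine .inl ⟨M.eq_simpleRoot_of_eq_smul hx (a := p₁) ?_,
      M.eq_simpleRoot_of_eq_smul hy (a := q₂) ?_⟩
    · rw [← h₁, zero_smul, add_zero]
    · rw [← h₂, zero_smul, zero_add]
  · simp [hD] at hD0

/-- The group preserves the form, not the labels, so labels are recovered from Gram entries by
injectivity of cosine on `[0, π]`. -/
theorem eq_of_gram_eq {i j x y : B} (hij : i ≠ j) (h : M i j ≠ 0)
    (hg : M.gram x y = M.gram i j) : M x y = M i j := by
  have hs := M.sin_pi_div_pos hij h
  have hcos : Real.cos (Real.pi / M i j) ≠ 1 := by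
    intro h1
    have := Real.sin_sq_add_cos_sq (Real.pi / M i j)
    rw [h1] at this
    nlinarith
  rw [M.gram_of_ne_zero h] at hg
  have h0 : M x y ≠ 0 := by
    intro h0
    rw [gram, if_pos h0] at hg
    exact hcos (by linarith)
  rw [M.gram_of_ne_zero h0] at hg
  have hmem : ∀ n : ℕ, n ≠ 0 → Real.pi / n ∈ Set.Icc 0 Real.pi := by
    intro n hn
    have h1 : (1 : ℝ) ≤ n := by exact_mod_cast Nat.one_le_iff_ne_zero.mpr hn
    have := Real.pi_pos
    exact ⟨by positivity, div_le_self this.le h1⟩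
  have heq := Real.injOn_cos (hmem _ h0) (hmem _ h) (neg_injective hg)
  have hx : (M x y : ℝ) ≠ 0 := by exact_mod_cast h0
  have hi : (M i j : ℝ) ≠ 0 := by exact_mod_cast h
  rw [div_eq_div_iff hx hi] at heq
  exact_mod_cast (mul_left_cancel₀ Real.pi_ne_zero heq).symm

/-- The elements of a Coxeter group which map all simple roots of a given set to positive roots,
that is, the elements of minimal length in their cosets of a standard parabolic subgroup. -/
def MinimalRep (X : Set B) : Type _ := {w : M.Group // ∀ x ∈ X, 0 ≤ ρ w (e x)}

section Walk

variable {M} {X : Set B} {K : Type*} [Group K] (lab : X → K)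

open Classical in
/-- One step of the labelled action: a simple reflection either moves a minimal coset
representative, or it fixes its coset and contributes a label. -/
noncomputable def walkStep (i : B) (s : M.MinimalRep X × K) : M.MinimalRep X × K :=
  if h : ∃ x : X, ρ s.1.1 (e (x : B)) = e i then (s.1, lab h.choose * s.2)
  else (⟨M.toCoxeterSystem.simple i * s.1.1, fun x hx =>
    M.geomRep_simple_mul_nonneg (s.1.2 x hx) fun he => h ⟨⟨x, hx⟩, he⟩⟩, s.2)

theorem walkStep_of_eq {i : B} {s : M.MinimalRep X × K} {x : X}
    (h : ρ s.1.1 (e (x : B)) = e i) : walkStep lab i s = (s.1, lab x * s.2) := by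
  have hex : ∃ x : X, ρ s.1.1 (e (x : B)) = e i := ⟨x, h⟩
  have hx : hex.choose = x := Subtype.ext (simpleRoot_injective
    (M.geomRep_apply_injective s.1.1 (hex.choose_spec.trans h.symm)))
  rw [walkStep, dif_pos hex, hx]

theorem walkStep_of_ne {i : B} {s : M.MinimalRep X × K}
    (h : ∀ x : X, ρ s.1.1 (e (x : B)) ≠ e i) :
    (walkStep lab i s).1.1 = M.toCoxeterSystem.simple i * s.1.1 ∧ (walkStep lab i s).2 = s.2 := by
  rw [walkStep, dif_neg (by push Not; exact h)]
  exact ⟨rfl, rfl⟩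

/-- A moving step cannot be followed by a labelling step with the same `i`: this would make the
image of `e x` before the move equal to `-e i`, which is not positive. -/
theorem walkStep_walkStep (lab' : X → K) (h : ∀ x, lab x * lab' x = 1) (i : B)
    (s : M.MinimalRep X × K) : walkStep lab i (walkStep lab' i s) = s := by
  by_cases hs : ∃ x : X, ρ s.1.1 (e (x : B)) = e i
  · obtain ⟨x, hx⟩ := hs
    have h1 := walkStep_of_eq lab' hx
    rw [h1, walkStep_of_eq lab (x := x) (by exact hx)]
    simp only [← mul_assoc, h, one_mul]
  · push Not at hs
    obtain ⟨h1, h2⟩ := walkStep_of_ne lab' hs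
    obtain ⟨h3, h4⟩ := walkStep_of_ne lab (s := walkStep lab' i s) (i := i) (by
      intro x hx
      rw [h1, map_mul, Module.End.mul_apply, geomRep_simple] at hx
      have hx' : ρ s.1.1 (e (x : B)) = -e i := by
        rw [← M.simpleReflection_simpleReflection i (ρ s.1.1 (e (x : B))), hx,
          simpleReflection_simpleRoot_self]
      exact M.geomRep_simpleRoot_ne_neg (s.1.2 x x.2) hx')
    refine Prod.ext (Subtype.ext ?_) (h4.trans h2)
    rw [h3, h1, simple_mul_simple_cancel_left]

/-- The step of the labelled action as a permutation. -/
noncomputable def walkPerm (i : B) : Equiv.Perm (M.MinimalRep X × K) where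
  toFun := walkStep lab i
  invFun := walkStep (fun x => (lab x)⁻¹) i
  left_inv := walkStep_walkStep _ _ (fun x => inv_mul_cancel (lab x)) i
  right_inv := walkStep_walkStep _ _ (fun x => mul_inv_cancel (lab x)) i

theorem walkPerm_apply (i : B) (s : M.MinimalRep X × K) :
    walkPerm lab i s = walkStep lab i s := rfl

theorem walkPerm_mul_right (i : B) (w : M.MinimalRep X) (a b : K) :
    walkPerm lab i (w, a * b) = ((walkPerm lab i (w, a)).1, (walkPerm lab i (w, a)).2 * b) := by
  simp only [walkPerm_apply, walkStep]
  split_ifs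
  · simp only [mul_assoc]
  · rfl

theorem walk_of_ne {i j : B} {k : ℕ} (s : M.MinimalRep X × K)
    (h : ∀ l < k, ∀ x : X, ρ (π (alternatingWord i j l)) (ρ s.1.1 (e (x : B))) ≠
      e (if Even l then j else i)) :
    (((alternatingWord i j k).map (walkPerm lab)).prod s).1.1 = π (alternatingWord i j k) * s.1.1 ∧
      (((alternatingWord i j k).map (walkPerm lab)).prod s).2 = s.2 := by
  induction k with
  | zero => simp [alternatingWord]
  | succ k ih =>
    obtain ⟨h1, h2⟩ := ih fun l hl => h l (by omega)
    rw [alternatingWord_succ', List.map_cons, List.prod_cons, Equiv.Perm.mul_apply,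
      walkPerm_apply]
    obtain ⟨h3, h4⟩ := walkStep_of_ne lab (i := if Even k then j else i)
      (s := ((alternatingWord i j k).map (walkPerm lab)).prod s) (by
        intro x
        rw [h1, map_mul, Module.End.mul_apply]
        exact h k (by omega) x)
    refine ⟨?_, h4.trans h2⟩
    rw [h3, h1, wordProd_cons, mul_assoc]

/-- Neither letter moves the representative, so the word is copied into the labels with `x` and `y`
for `i` and `j`. -/
theorem walk_of_eq {i j : B} {x y : X} (k : ℕ) (w : M.MinimalRep X) (a : K)
    (hx : ρ w.1 (e (x : B)) = e i) (hy : ρ w.1 (e (y : B)) = e j) :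
    ((alternatingWord i j k).map (walkPerm lab)).prod (w, a) =
      (w, ((alternatingWord x y k).map lab).prod * a) := by
  induction k with
  | zero => simp [alternatingWord]
  | succ k ih =>
    rw [alternatingWord_succ', alternatingWord_succ', List.map_cons, List.prod_cons,
      Equiv.Perm.mul_apply, ih, walkPerm_apply, List.map_cons, List.prod_cons]
    split_ifs
    · rw [walkStep_of_eq lab (x := y) (by exact hy), mul_assoc]
    · rw [walkStep_of_eq lab (x := x) (by exact hx), mul_assoc]

/-- After a label has been contributed, the remaining letters of a braid word do not contribute. -/
theorem walk_after_label {i j : B} (hij : i ≠ j) {k : ℕ} (hk : k < M i j)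
    (s : M.MinimalRep X × K) {x : X} (hx : ρ s.1.1 (e (x : B)) = e i)
    (huniq : ∀ z : X, ρ s.1.1 (e (z : B)) ∈ rootPlane i j → z = x) :
    (((alternatingWord i j k).map (walkPerm lab)).prod s).1.1 = π (alternatingWord i j k) * s.1.1 ∧
      (((alternatingWord i j k).map (walkPerm lab)).prod s).2 = s.2 := by
  refine walk_of_ne lab s fun l hl z hz => ?_
  have hzm : ρ (π (alternatingWord i j l)) (ρ s.1.1 (e (z : B))) ∈ rootPlane i j := by
    rw [hz]
    split_ifs
    · exact right_mem_rootPlane i j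
    · exact left_mem_rootPlane i j
  rw [geomRep_alternatingWord_mem_iff] at hzm
  rw [huniq z hzm, hx, geomRep_alternatingWord] at hz
  have hpos := M.dihedralCoeff_pos hij (k := l + 1) (by omega) (fun _ => by omega)
  by_cases hl : Even l
  · rw [if_pos hl, if_pos hl] at hz
    have := congrArg (· i) hz
    simp [simpleRoot_apply_self, simpleRoot_apply_of_ne hij.symm] at this
    linarith
  · rw [if_neg hl, if_neg hl] at hz
    have := congrArg (· j) hz
    simp [simpleRoot_apply_self, simpleRoot_apply_of_ne hij] at this
    linarith

theorem geomRep_braidWord_simpleRoot_nonpos {i j : B} (hij : i ≠ j) (h : M i j ≠ 0) :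
    ρ (π (alternatingWord i j (M i j))) (e i) ≤ 0 := by
  rw [geomRep_alternatingWord, M.dihedralCoeff_eq_zero hij h, M.dihedralCoeff_succ hij h]
  split_ifs <;> simpa using simpleRoot_nonneg _

/-- The two forms of the braid word are the same group element; one form handles `e i`, the other `e
j`. -/
theorem geomRep_braidWord_nonpos {i j : B} (hij : i ≠ j) (h : M i j ≠ 0) {x : B →₀ ℝ}
    (hx : 0 ≤ x) (hxm : x ∈ rootPlane i j) : ρ (π (alternatingWord i j (M i j))) x ≤ 0 := by
  obtain ⟨a, b, rfl⟩ := mem_rootPlane.mp hxm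
  obtain ⟨ha, hb⟩ := combination_nonneg hij hx
  have h1 := geomRep_braidWord_simpleRoot_nonpos hij h
  have h2 : ρ (π (alternatingWord i j (M i j))) (e j) ≤ 0 := by
    have := geomRep_braidWord_simpleRoot_nonpos (M := M) hij.symm (by rwa [M.symmetric])
    rwa [M.toCoxeterSystem.wordProd_braidWord_eq j i] at this
  rw [map_add, map_smul, map_smul]
  exact add_nonpos (smul_nonpos_of_nonneg_of_nonpos ha h1) (smul_nonpos_of_nonneg_of_nonpos hb h2)

/-- A braid word contributes exactly one label if exactly one root lies in the plane spanned by its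
simple roots. -/
theorem walk_braidWord_of_unique {i j : B} (hij : i ≠ j) (h : M i j ≠ 0)
    (s : M.MinimalRep X × K) {x : X} (hx : ρ s.1.1 (e (x : B)) ∈ rootPlane i j)
    (huniq : ∀ z : X, ρ s.1.1 (e (z : B)) ∈ rootPlane i j → z = x) :
    (((alternatingWord i j (M i j)).map (walkPerm lab)).prod s).1.1 =
        π (alternatingWord i j (M i j)) * s.1.1 * M.toCoxeterSystem.simple x ∧
      (((alternatingWord i j (M i j)).map (walkPerm lab)).prod s).2 = lab x * s.2 := by
  classical
  have hmem : ∀ (l : ℕ) (z : X), ρ (π (alternatingWord i j l)) (ρ s.1.1 (e (z : B))) =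
      e (if Even l then j else i) → z = x := by
    intro l z hz
    refine huniq z ((M.geomRep_alternatingWord_mem_iff (k := l)).mp ?_)
    rw [hz]
    split_ifs
    · exact right_mem_rootPlane i j
    · exact left_mem_rootPlane i j
  -- If no letter contributed a label, the whole braid word would move the representative and make
  -- the image of `e x` nonpositive, against minimality.
  have hex : ∃ l, l < M i j ∧ ρ (π (alternatingWord i j l)) (ρ s.1.1 (e (x : B))) =
      e (if Even l then j else i) := by
    by_contra! hcon
    have h1 := (walk_of_ne lab s (k := M i j) fun l hl z hz =>
      hcon l hl (hmem l z hz ▸ hz)).1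
    have h2 := (((alternatingWord i j (M i j)).map (walkPerm lab)).prod s).1.2 x x.2
    rw [h1, map_mul, Module.End.mul_apply] at h2
    have h3 := le_antisymm (geomRep_braidWord_nonpos hij h (s.1.2 x x.2) hx) h2
    have h4 := M.geomRep_apply_injective _ (h3.trans (map_zero _).symm)
    have h5 := M.geomRep_apply_injective _ (h4.trans (map_zero _).symm)
    exact simpleRoot_not_nonpos _ h5.le
  obtain ⟨hl, hhit⟩ := Nat.find_spec hex
  have hmin : ∀ l < Nat.find hex, ∀ z : X, ρ (π (alternatingWord i j l)) (ρ s.1.1 (e (z : B))) ≠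
      e (if Even l then j else i) := by
    intro l hll z hz
    exact Nat.find_min hex hll ⟨by omega, hmem l z hz ▸ hz⟩
  generalize Nat.find hex = l at hl hhit hmin
  obtain ⟨h1, h2⟩ := walk_of_ne lab s hmin
  set s' := ((alternatingWord i j l).map (walkPerm lab)).prod s with hs'
  obtain ⟨p, hp⟩ : ∃ p, M i j = p + (l + 1) := ⟨M i j - (l + 1), by omega⟩
  have hhit' : ρ s'.1.1 (e (x : B)) = e (if Even l then j else i) := by
    rw [h1, map_mul, Module.End.mul_apply, hhit]
  have hstep : ((alternatingWord i j (l + 1)).map (walkPerm lab)).prod s =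
      (s'.1, lab x * s'.2) := by
    rw [alternatingWord_succ', List.map_cons, List.prod_cons, Equiv.Perm.mul_apply, walkPerm_apply,
      ← hs', walkStep_of_eq lab hhit']
  have huniq' : ∀ z : X, ρ s'.1.1 (e (z : B)) ∈ rootPlane i j → z = x := by
    intro z hz
    rw [h1, map_mul, Module.End.mul_apply, geomRep_alternatingWord_mem_iff] at hz
    exact huniq z hz
  -- The letter that fixed the coset is missing from the new representative; it passes through to
  -- the right as the reflection of `x`, the extra factor in the conclusion.
  have hcomm := M.simple_mul_eq_mul_simple hhit'
  have hword : alternatingWord i j (M i j) =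
      (if Even l then alternatingWord j i p else alternatingWord i j p) ++
        alternatingWord i j (l + 1) := by
    rw [hp, alternatingWord_add]
    congr 1
    simp only [Nat.even_add_one]
    split_ifs <;> simp_all
  have hsplit : π (alternatingWord i j (M i j)) = π (if Even l then alternatingWord j i p else
      alternatingWord i j p) * (M.toCoxeterSystem.simple (if Even l then j else i) *
        π (alternatingWord i j l)) := by
    rw [hword, wordProd_append, alternatingWord_succ', wordProd_cons]
  have hrest : (((if Even l then alternatingWord j i p else alternatingWord i j p).map
        (walkPerm lab)).prod (s'.1, lab x * s'.2)).1.1 =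
      π (if Even l then alternatingWord j i p else alternatingWord i j p) * s'.1.1 ∧
      (((if Even l then alternatingWord j i p else alternatingWord i j p).map
        (walkPerm lab)).prod (s'.1, lab x * s'.2)).2 = lab x * s'.2 := by
    by_cases hle : Even l
    · simp only [if_pos hle] at hhit' ⊢
      exact walk_after_label lab hij.symm (by rw [M.symmetric]; omega) (s'.1, lab x * s'.2) hhit'
        fun z hz => huniq' z (by rwa [rootPlane_comm])
    · simp only [if_neg hle] at hhit' ⊢
      exact walk_after_label lab hij (by omega) (s'.1, lab x * s'.2) hhit' huniq'
  have hfull : ((alternatingWord i j (M i j)).map (walkPerm lab)).prod s =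
      ((if Even l then alternatingWord j i p else alternatingWord i j p).map
        (walkPerm lab)).prod (s'.1, lab x * s'.2) := by
    rw [← hstep, hword, List.map_append, List.prod_append, Equiv.Perm.mul_apply]
  rw [hfull]
  refine ⟨?_, by rw [hrest.2, h2]⟩
  rw [hrest.1, hsplit, mul_assoc, mul_assoc, mul_assoc, ← mul_assoc _ s.1.1, ← h1, ← hcomm,
    simple_mul_simple_cancel_left]

/-- The labelled action satisfies the braid relations. -/
theorem prod_map_walkPerm_braidWord
    (hlab : ∀ x y : X, x ≠ y → M x y ≠ 0 →
      ((alternatingWord x y (M x y)).map lab).prod = ((alternatingWord y x (M x y)).map lab).prod)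
    {i j : B} (hij : i ≠ j) (h : M i j ≠ 0) :
    ((alternatingWord i j (M i j)).map (walkPerm (M := M) lab)).prod =
      ((alternatingWord j i (M i j)).map (walkPerm lab)).prod := by
  have hπ : π (alternatingWord i j (M i j)) = π (alternatingWord j i (M j i)) :=
    M.toCoxeterSystem.wordProd_braidWord_eq i j
  have h' : M j i ≠ 0 := by rwa [M.symmetric]
  -- With two roots in the plane, both letters stay at `w`, and the relation becomes the braid
  -- relation between labels, since `x` and `y` have the same Coxeter entry as `i` and `j`.
  have two : ∀ (i j : B) (_ : i ≠ j) (_ : M i j ≠ 0) (w : M.MinimalRep X) (a : K) (x y : X),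
      ρ w.1 (e (x : B)) = e i → ρ w.1 (e (y : B)) = e j →
      ((alternatingWord i j (M i j)).map (walkPerm (M := M) lab)).prod (w, a) =
      ((alternatingWord j i (M i j)).map (walkPerm lab)).prod (w, a) := by
    intro i j hij h w a x y hx hy
    have hxy : x ≠ y := by
      rintro rfl
      exact hij (simpleRoot_injective (hx.symm.trans hy))
    have hM : M x y = M i j := by
      refine M.eq_of_gram_eq hij h ?_
      rw [← form_simpleRoot, ← M.form_geomRep w.1, hx, hy, form_simpleRoot]
    rw [walk_of_eq lab _ w a hx hy, walk_of_eq lab _ w a hy hx, ← hM,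
      hlab x y hxy (by rwa [hM])]
  refine Equiv.ext fun s => ?_
  by_cases hex : ∃ x : X, ρ s.1.1 (e (x : B)) ∈ rootPlane i j
  · obtain ⟨x, hx⟩ := hex
    by_cases huniq : ∀ z : X, ρ s.1.1 (e (z : B)) ∈ rootPlane i j → z = x
    · obtain ⟨h1, h2⟩ := walk_braidWord_of_unique lab hij h s hx huniq
      obtain ⟨h3, h4⟩ := walk_braidWord_of_unique lab hij.symm h' s (by rwa [rootPlane_comm])
        fun z hz => huniq z (by rwa [rootPlane_comm])
      rw [← hπ] at h3
      rw [M.symmetric j i] at h3 h4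
      exact Prod.ext (Subtype.ext (h1.trans h3.symm)) (h2.trans h4.symm)
    · push Not at huniq
      obtain ⟨y, hy, hyx⟩ := huniq
      rcases M.eq_simpleRoots_of_mem_rootPlane hij (fun he => hyx (Subtype.ext he.symm))
        (s.1.2 x x.2) (s.1.2 y y.2) hx hy with ⟨hxi, hyj⟩ | ⟨hxj, hyi⟩
      · exact two i j hij h s.1 s.2 x y hxi hyj
      · exact two i j hij h s.1 s.2 y x hyi hxj
  · push Not at hex
    have hne : ∀ (l : ℕ) (a b : B), rootPlane a b = rootPlane i j → ∀ z : X,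
        ρ (π (alternatingWord a b l)) (ρ s.1.1 (e (z : B))) ≠ e (if Even l then b else a) := by
      intro l a b hab z hz
      refine hex z ?_
      rw [← hab, ← M.geomRep_alternatingWord_mem_iff (k := l), hz]
      split_ifs
      · exact right_mem_rootPlane a b
      · exact left_mem_rootPlane a b
    obtain ⟨h1, h2⟩ := walk_of_ne lab s (k := M i j) fun l _ => hne l i j rfl
    obtain ⟨h3, h4⟩ := walk_of_ne lab s (k := M j i) fun l _ => hne l j i (rootPlane_comm j i)
    rw [← hπ] at h3
    rw [M.symmetric j i] at h3 h4
    exact Prod.ext (Subtype.ext (h1.trans h3.symm)) (h2.trans h4.symm)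

end Walk

end CoxeterMatrix

/-! ### Alternating products and the universal property of Artin groups -/

theorem map_alternatingProd {M : Type*} {N : Type*} [Monoid M] [Monoid N] (f : M →* N)
    (a b : M) (n : ℕ) : f (alternatingProd a b n) = alternatingProd (f a) (f b) n := by
  induction n generalizing a b with
  | zero => simp [alternatingProd]
  | succ n ih => rw [alternatingProd, alternatingProd, map_mul, ih]

theorem prod_map_alternatingWord {B : Type*} {N : Type*} [Monoid N] (f : B → N) (i j : B) (n : ℕ) :
    ((CoxeterSystem.alternatingWord i j n).map f).prod =
      if Even n then alternatingProd (f i) (f j) n else alternatingProd (f j) (f i) n := by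
  induction n with
  | zero => simp [CoxeterSystem.alternatingWord, alternatingProd]
  | succ n ih =>
    rw [CoxeterSystem.alternatingWord_succ', List.map_cons, List.prod_cons, ih]
    by_cases hn : Even n
    · rw [if_pos hn, if_pos hn, if_neg (by simpa [Nat.even_add_one] using hn), alternatingProd]
    · rw [if_neg hn, if_neg hn, if_pos (by simpa [Nat.even_add_one] using hn), alternatingProd]

theorem prod_map_alternatingWord_eq_iff {B : Type*} {N : Type*} [Monoid N] (f : B → N) (i j : B)
    (n : ℕ) : ((CoxeterSystem.alternatingWord i j n).map f).prod =
        ((CoxeterSystem.alternatingWord j i n).map f).prod ↔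
      alternatingProd (f i) (f j) n = alternatingProd (f j) (f i) n := by
  rw [prod_map_alternatingWord, prod_map_alternatingWord]
  split_ifs
  · rfl
  · exact eq_comm

namespace ArtinGroup

variable {V : Type u} {Γ : SimpleGraph V} {m : Γ.edgeSet → ℕ}

theorem alternatingProd_gen {v w : V} (h : Γ.Adj v w) :
    alternatingProd (gen Γ m v) (gen Γ m w) (m ⟨s(v, w), h⟩) =
      alternatingProd (gen Γ m w) (gen Γ m v) (m ⟨s(v, w), h⟩) := by
  have := PresentedGroup.one_of_mem (rels := artinRelators Γ m) ⟨v, w, h, rfl⟩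
  rw [map_mul, map_inv, map_alternatingProd, map_alternatingProd] at this
  exact mul_inv_eq_one.mp this

/-- The universal property of an Artin group. -/
def lift {K : Type*} [Group K] (f : V → K)
    (hf : ∀ (v w : V) (h : Γ.Adj v w), alternatingProd (f v) (f w) (m ⟨s(v, w), h⟩) =
      alternatingProd (f w) (f v) (m ⟨s(v, w), h⟩)) : ArtinGroup Γ m →* K :=
  PresentedGroup.toGroup (f := f) (by
    rintro _ ⟨v, w, h, rfl⟩
    rw [map_mul, map_inv, map_alternatingProd, map_alternatingProd, FreeGroup.lift_apply_of,
      FreeGroup.lift_apply_of, hf v w h, mul_inv_cancel])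

@[simp] theorem lift_gen {K : Type*} [Group K] (f : V → K)
    (hf : ∀ (v w : V) (h : Γ.Adj v w), alternatingProd (f v) (f w) (m ⟨s(v, w), h⟩) =
      alternatingProd (f w) (f v) (m ⟨s(v, w), h⟩)) (v : V) : lift f hf (gen Γ m v) = f v :=
  PresentedGroup.toGroup.of _

theorem gen_mem {X : Set V} {v : V} (h : v ∈ X) : gen Γ m v ∈ standardParabolic Γ m X :=
  Subgroup.subset_closure ⟨v, h, rfl⟩

theorem standardParabolic_univ : standardParabolic Γ m Set.univ = ⊤ := by
  rw [standardParabolic, Set.image_univ]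
  exact PresentedGroup.closure_range_of _

/-! ### The Coxeter quotient of an Artin group -/

section Coxeter

open Classical in
/-- The Coxeter matrix of an edge-labeled graph. -/
noncomputable def coxeterMatrix (Γ : SimpleGraph V) (m : Γ.edgeSet → ℕ) (hm : ∀ e, 2 ≤ m e) :
    CoxeterMatrix V where
  M v w := if v = w then 1 else if h : Γ.Adj v w then m ⟨s(v, w), h⟩ else 0
  isSymm := by
    refine Matrix.IsSymm.ext fun v w => ?_
    by_cases hvw : v = w
    · simp [hvw]
    · by_cases h : Γ.Adj v w
      · simp [hvw, Ne.symm hvw, h, h.symm, Sym2.eq_swap]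
      · simp [hvw, Ne.symm hvw, h, mt SimpleGraph.Adj.symm h]
  diagonal v := by simp
  off_diagonal v w hvw := by
    rw [if_neg hvw]
    split_ifs with h
    · have := hm ⟨s(v, w), h⟩
      omega
    · simp

variable (hm : ∀ e, 2 ≤ m e)

theorem coxeterMatrix_of_adj {v w : V} (h : Γ.Adj v w) :
    coxeterMatrix Γ m hm v w = m ⟨s(v, w), h⟩ := by
  simp [coxeterMatrix, h, h.ne]

theorem coxeterMatrix_ne_zero {v w : V} (h : Γ.Adj v w) : coxeterMatrix Γ m hm v w ≠ 0 := by
  rw [coxeterMatrix_of_adj hm h]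
  have := hm ⟨s(v, w), h⟩
  omega

theorem adj_of_coxeterMatrix_ne_zero {v w : V} (hvw : v ≠ w) (h : coxeterMatrix Γ m hm v w ≠ 0) :
    Γ.Adj v w := by
  by_contra hadj
  simp [coxeterMatrix, hvw, hadj] at h

/-- The projection of an Artin group onto its Coxeter group. -/
noncomputable def toCoxeter : ArtinGroup Γ m →* (coxeterMatrix Γ m hm).Group :=
  lift (coxeterMatrix Γ m hm).toCoxeterSystem.simple fun v w h => by
    rw [← prod_map_alternatingWord_eq_iff, ← coxeterMatrix_of_adj hm h]
    have := (coxeterMatrix Γ m hm).toCoxeterSystem.wordProd_braidWord_eq v w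
    rwa [CoxeterSystem.braidWord, CoxeterSystem.braidWord, (coxeterMatrix Γ m hm).symmetric w v]
      at this

/-- In the geometric representation, elements of `A_X` do not change coordinate `v` when `v` is
outside `X`, while the generator `v` negates its own simple root. -/
theorem gen_mem_standardParabolic_iff (hm : ∀ e, 2 ≤ m e) {X : Set V} {v : V} :
    gen Γ m v ∈ standardParabolic Γ m X ↔ v ∈ X := by
  refine ⟨fun h => ?_, gen_mem⟩
  by_contra hv
  set M := coxeterMatrix Γ m hm
  have key : ∀ g ∈ standardParabolic Γ m X, ∀ x, M.geomRep (toCoxeter hm g) x v = x v := by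
    intro g hg
    induction hg using Subgroup.closure_induction with
    | mem _ hg =>
      obtain ⟨w, hw, rfl⟩ := hg
      intro x
      have hwv : w ≠ v := by
        rintro rfl
        exact hv hw
      rw [toCoxeter, lift_gen, M.geomRep_simple, M.simpleReflection_apply]
      simp [CoxeterMatrix.simpleRoot_apply_of_ne hwv]
    | one => simp
    | mul g h _ _ hg hh =>
      intro x
      rw [map_mul, map_mul, Module.End.mul_apply, hg, hh]
    | inv g _ hg =>
      intro x
      rw [map_inv, ← hg, M.geomRep_apply_inv_apply]
  have := key _ h (CoxeterMatrix.simpleRoot v)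
  rw [toCoxeter, lift_gen, M.geomRep_simple, M.simpleReflection_simpleRoot_self] at this
  simp [CoxeterMatrix.simpleRoot_apply_self] at this
  linarith

/-! ### Inclusions of parabolic subgroups -/

/-- The generators of a standard parabolic subgroup. -/
def parabolicGen (Γ : SimpleGraph V) (m : Γ.edgeSet → ℕ) (X : Set V) (x : X) :
    standardParabolic Γ m X := ⟨gen Γ m x, gen_mem x.2⟩

theorem alternatingProd_parabolicGen {X : Set V} {x y : X} (h : Γ.Adj x y) :
    alternatingProd (parabolicGen Γ m X x) (parabolicGen Γ m X y) (m ⟨s((x : V), (y : V)), h⟩) =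
      alternatingProd (parabolicGen Γ m X y) (parabolicGen Γ m X x)
        (m ⟨s((x : V), (y : V)), h⟩) := by
  apply (standardParabolic Γ m X).subtype_injective
  rw [map_alternatingProd, map_alternatingProd]
  exact alternatingProd_gen h

/-- The labelled action of an Artin group. -/
noncomputable def walkAction (X : Set V) : ArtinGroup Γ m →*
    Equiv.Perm ((coxeterMatrix Γ m hm).MinimalRep X × standardParabolic Γ m X) :=
  lift (CoxeterMatrix.walkPerm (parabolicGen Γ m X)) fun v w h => by
    rw [← prod_map_alternatingWord_eq_iff, ← coxeterMatrix_of_adj hm h]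
    refine CoxeterMatrix.prod_map_walkPerm_braidWord _ (fun x y hxy h0 => ?_) h.ne
      (coxeterMatrix_ne_zero hm h)
    have hadj := adj_of_coxeterMatrix_ne_zero hm (fun he => hxy (Subtype.ext he)) h0
    rw [prod_map_alternatingWord_eq_iff, coxeterMatrix_of_adj hm hadj]
    exact alternatingProd_parabolicGen hadj

variable {X : Set V}

theorem walkAction_mul_right (g : ArtinGroup Γ m) (w : (coxeterMatrix Γ m hm).MinimalRep X)
    (a b : standardParabolic Γ m X) :
    walkAction hm X g (w, a * b) =
      ((walkAction hm X g (w, a)).1, (walkAction hm X g (w, a)).2 * b) := by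
  let R : Equiv.Perm ((coxeterMatrix Γ m hm).MinimalRep X × standardParabolic Γ m X) :=
    Equiv.prodCongr (Equiv.refl _) (Equiv.mulRight b)
  have hR : ∀ s, R s = (s.1, s.2 * b) := fun s => rfl
  suffices h : Commute (walkAction hm X g) R from DFunLike.congr_fun h.eq (w, a)
  have hg : g ∈ standardParabolic Γ m Set.univ :=
    standardParabolic_univ (Γ := Γ) ▸ Subgroup.mem_top g
  induction hg using Subgroup.closure_induction with
  | mem _ hg =>
    obtain ⟨v, -, rfl⟩ := hg
    refine Equiv.ext fun s => ?_
    rw [walkAction, lift_gen, Equiv.Perm.mul_apply, Equiv.Perm.mul_apply, hR, hR]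
    exact CoxeterMatrix.walkPerm_mul_right _ _ _ _ _
  | one => rw [map_one]; exact Commute.one_left R
  | mul g h _ _ hg hh => rw [map_mul]; exact hg.mul_left hh
  | inv g _ hg => rw [map_inv]; exact hg.inv_left

/-- The trivial coset. -/
noncomputable def trivialRep (X : Set V) : (coxeterMatrix Γ m hm).MinimalRep X :=
  ⟨1, fun x _ => by
    rw [map_one, Module.End.one_apply]
    exact CoxeterMatrix.simpleRoot_nonneg x⟩

theorem walkAction_trivialRep {h : ArtinGroup Γ m} (hh : h ∈ standardParabolic Γ m X)
    (a : standardParabolic Γ m X) :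
    walkAction hm X h (trivialRep hm X, a) = (trivialRep hm X, ⟨h, hh⟩ * a) := by
  induction hh using Subgroup.closure_induction generalizing a with
  | mem _ hx =>
    obtain ⟨x, hx, rfl⟩ := hx
    rw [walkAction, lift_gen, CoxeterMatrix.walkPerm_apply,
      CoxeterMatrix.walkStep_of_eq _ (x := ⟨x, hx⟩) (by simp [trivialRep])]
    rfl
  | one =>
    rw [map_one, Equiv.Perm.one_apply]
    exact Prod.ext rfl (one_mul a).symm
  | mul g h _ _ hg hh =>
    rw [map_mul, Equiv.Perm.mul_apply, hh, hg, ← mul_assoc]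
    rfl
  | inv g hg ih =>
    rw [map_inv, Equiv.Perm.inv_eq_iff_eq, ih, ← mul_assoc]
    congr 2
    exact Subtype.ext (by simp)

/-- A conjugate of a standard parabolic subgroup which is contained in a standard parabolic subgroup
`A_X` is conjugate in `A_X` to the standard parabolic subgroup of a subset of `X`. -/
theorem exists_map_conj_eq_of_le (hm : ∀ e, 2 ≤ m e) {Y : Set V} {g : ArtinGroup Γ m}
    (h : (standardParabolic Γ m Y).map (MulAut.conj g).toMonoidHom ≤ standardParabolic Γ m X) :
    ∃ b ∈ standardParabolic Γ m X, ∃ f : Y → V, Function.Injective f ∧ (∀ y, f y ∈ X) ∧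
      (standardParabolic Γ m Y).map (MulAut.conj g).toMonoidHom =
        (standardParabolic Γ m (Set.range f)).map (MulAut.conj b).toMonoidHom := by
  set M := coxeterMatrix Γ m hm
  obtain ⟨⟨w, b⟩, hwb⟩ : ∃ s, s = walkAction hm X g⁻¹ (trivialRep hm X, 1) := ⟨_, rfl⟩
  have key : ∀ y : Y, ∃ x : X, M.geomRep w.1 (CoxeterMatrix.simpleRoot (x : V)) =
      CoxeterMatrix.simpleRoot (y : V) ∧
      g * gen Γ m y * g⁻¹ = (b : ArtinGroup Γ m)⁻¹ * gen Γ m x * b := by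
    intro y
    have hk : g * gen Γ m y * g⁻¹ ∈ standardParabolic Γ m X :=
      h ⟨gen Γ m y, gen_mem y.2, rfl⟩
    -- Write `k` for `g y g⁻¹`. Then `y g⁻¹ = g⁻¹ k`, `k` acts on the base point by the label `k`,
    -- and the action commutes with right multiplication of labels.
    have h1 : walkAction hm X (gen Γ m y) (w, b) = (w, b * ⟨_, hk⟩) := by
      have h2 := walkAction_mul_right hm g⁻¹ (trivialRep hm X) 1 ⟨_, hk⟩
      rw [← hwb, one_mul] at h2
      rw [← h2, hwb, ← mul_one (⟨_, hk⟩ : standardParabolic Γ m X), ← walkAction_trivialRep hm hk,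
        ← Equiv.Perm.mul_apply, ← Equiv.Perm.mul_apply, ← map_mul, ← map_mul]
      congr 2
      group
    rw [walkAction, lift_gen, CoxeterMatrix.walkPerm_apply] at h1
    by_cases hx : ∃ x : X, M.geomRep w.1 (CoxeterMatrix.simpleRoot (x : V)) =
      CoxeterMatrix.simpleRoot (y : V)
    · obtain ⟨x, hx⟩ := hx
      refine ⟨x, hx, ?_⟩
      rw [CoxeterMatrix.walkStep_of_eq _ (x := x) (by exact hx)] at h1
      have h3 : gen Γ m x * (b : ArtinGroup Γ m) = b * (g * gen Γ m y * g⁻¹) :=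
        congrArg (fun s => (s.2 : ArtinGroup Γ m)) h1
      rw [mul_assoc _ (gen Γ m (x : V)), h3, inv_mul_cancel_left]
    · push Not at hx
      have h3 := (CoxeterMatrix.walkStep_of_ne (parabolicGen Γ m X) (s := (w, b)) hx).1
      rw [h1] at h3
      -- A moving step would give `s_y w = w`, impossible as a simple reflection has length one.
      have h4 : M.toCoxeterSystem.simple (y : V) = 1 := by
        simpa using h3.symm
      have h5 := M.toCoxeterSystem.length_simple (y : V)
      rw [h4, CoxeterSystem.length_one] at h5
      omega
  choose f hf hfg using key
  refine ⟨(b : ArtinGroup Γ m)⁻¹, inv_mem b.2, fun y => f y, ?_, fun y => (f y).2, ?_⟩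
  · intro y y' hyy
    have hyy' : f y = f y' := Subtype.ext hyy
    exact Subtype.ext (CoxeterMatrix.simpleRoot_injective ((hf y).symm.trans (hyy' ▸ hf y')))
  · simp only [standardParabolic, MonoidHom.map_closure]
    congr 1
    ext k
    constructor
    · rintro ⟨_, ⟨y, hy, rfl⟩, rfl⟩
      exact ⟨_, ⟨f ⟨y, hy⟩, ⟨⟨y, hy⟩, rfl⟩, rfl⟩, by simpa using (hfg ⟨y, hy⟩).symm⟩
    · rintro ⟨_, ⟨_, ⟨y, rfl⟩, rfl⟩, rfl⟩
      exact ⟨_, ⟨y, y.2, rfl⟩, by simpa using hfg y⟩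

end Coxeter

theorem map_conj_mul (g h : ArtinGroup Γ m) (P : Subgroup (ArtinGroup Γ m)) :
    P.map (MulAut.conj (g * h)).toMonoidHom =
      (P.map (MulAut.conj h).toMonoidHom).map (MulAut.conj g).toMonoidHom := by
  rw [Subgroup.map_map]
  congr 1
  ext x
  simp

theorem map_conj_le_map_conj_iff (g : ArtinGroup Γ m) (P Q : Subgroup (ArtinGroup Γ m)) :
    P.map (MulAut.conj g).toMonoidHom ≤ Q.map (MulAut.conj g).toMonoidHom ↔ P ≤ Q :=
  Subgroup.map_le_map_iff_of_injective (MulAut.conj g).injective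

theorem map_conj_eq_self {P : Subgroup (ArtinGroup Γ m)} {g : ArtinGroup Γ m} (hg : g ∈ P) :
    P.map (MulAut.conj g).toMonoidHom = P := by
  have key : ∀ g ∈ P, P.map (MulAut.conj g).toMonoidHom ≤ P := by
    rintro g hg _ ⟨x, hx, rfl⟩
    exact mul_mem (mul_mem hg hx) (inv_mem hg)
  refine le_antisymm (key g hg) ?_
  rw [← map_conj_le_map_conj_iff g⁻¹, ← map_conj_mul, inv_mul_cancel]
  have h1 : P.map (MulAut.conj (1 : ArtinGroup Γ m)).toMonoidHom = P := by
    rw [map_one]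
    exact Subgroup.map_id P
  rw [h1]
  exact key g⁻¹ (inv_mem hg)

/-- An inclusion of parabolic subgroups does not decrease the number of generators, and it is an
equality if this number remains the same. -/
theorem ncard_le_and_eq_of_map_conj_le [Finite V] (hm : ∀ e, 2 ≤ m e) {X Y : Set V}
    {g h : ArtinGroup Γ m} (hle : (standardParabolic Γ m Y).map (MulAut.conj g).toMonoidHom ≤
      (standardParabolic Γ m X).map (MulAut.conj h).toMonoidHom) :
    Y.ncard ≤ X.ncard ∧ (X.ncard ≤ Y.ncard →
      (standardParabolic Γ m Y).map (MulAut.conj g).toMonoidHom =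
        (standardParabolic Γ m X).map (MulAut.conj h).toMonoidHom) := by
  have hgh : g = h * (h⁻¹ * g) := by group
  rw [hgh, map_conj_mul, map_conj_le_map_conj_iff] at hle
  obtain ⟨b, hb, f, hf, hfX, heq⟩ := exists_map_conj_eq_of_le hm hle
  have hcard : (Set.range f).ncard = Y.ncard := by
    rw [← Set.image_univ, Set.ncard_image_of_injective _ hf, Set.ncard_univ, Nat.card_coe_set_eq]
  have hsub : Set.range f ⊆ X := by
    rintro _ ⟨y, rfl⟩
    exact hfX y
  refine ⟨hcard ▸ Set.ncard_le_ncard hsub, fun hXY => ?_⟩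
  rw [hgh, map_conj_mul, heq, Set.eq_of_subset_of_ncard_le hsub (hcard ▸ hXY), map_conj_eq_self hb]

end ArtinGroup

namespace ArtinGroup

open Monoid BassSerre

variable {V : Type u} {Γ : SimpleGraph V} {m : Γ.edgeSet → ℕ}

/-! ### The splitting of an Artin group over two nonadjacent vertices -/

/-- The vertex set of one of the two factors of the splitting over two nonadjacent vertices. -/
def factorSet (v w : V) (b : Bool) : Set V := {if b then v else w}ᶜ

/-- The two factors of the splitting over two nonadjacent vertices. -/
def factor (Γ : SimpleGraph V) (m : Γ.edgeSet → ℕ) (v w : V) (b : Bool) :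
    Subgroup (ArtinGroup Γ m) := standardParabolic Γ m (factorSet v w b)

theorem iSup_factor {v w : V} (hvw : v ≠ w) : ⨆ b, factor Γ m v w b = ⊤ := by
  rw [eq_top_iff, ← standardParabolic_univ, standardParabolic, Subgroup.closure_le]
  rintro _ ⟨u, -, rfl⟩
  by_cases h : u = v
  · subst h
    exact le_iSup (factor Γ m u w) false (gen_mem (by simpa [factorSet] using hvw))
  · exact le_iSup (factor Γ m v w) true (gen_mem (by simpa [factorSet] using h))

open Classical in
/-- The image of a generator in the amalgamated product. -/
noncomputable def toPushoutGen (Γ : SimpleGraph V) (m : Γ.edgeSet → ℕ) {v w : V} (hvw : v ≠ w)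
    (u : V) : PushoutI (baseInclusion (factor Γ m v w)) :=
  if h : u = v then PushoutI.of false ⟨gen Γ m u, gen_mem (by simpa [factorSet, h] using hvw)⟩
  else PushoutI.of true ⟨gen Γ m u, gen_mem (by simpa [factorSet] using h)⟩

/-- A generator lying in both factors belongs to the amalgamated subgroup, where the two inclusions
agree. -/
theorem toPushoutGen_eq {v w : V} (hvw : v ≠ w) {u : V} (b : Bool) (hu : u ∈ factorSet v w b) :
    toPushoutGen Γ m hvw u = PushoutI.of b ⟨gen Γ m u, gen_mem hu⟩ := by
  rw [toPushoutGen]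
  split_ifs with h
  · cases b with
    | false => rfl
    | true => exact absurd h (by simpa [factorSet] using hu)
  · cases b with
    | true => rfl
    | false =>
      have hmem : gen Γ m u ∈ (⨅ c, factor Γ m v w c : Subgroup (ArtinGroup Γ m)) := by
        rw [Subgroup.mem_iInf]
        rintro (_ | _)
        · exact gen_mem hu
        · exact gen_mem (by simpa [factorSet] using h)
      exact (PushoutI.of_apply_eq_base (baseInclusion (factor Γ m v w)) true ⟨_, hmem⟩).trans
        (PushoutI.of_apply_eq_base (baseInclusion (factor Γ m v w)) false ⟨_, hmem⟩).symm

/-- This is where nonadjacency enters: each braid relation already holds inside one factor. -/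
theorem exists_mem_factorSet {v w a c : V} (hne : v ≠ w) (hvw : ¬ Γ.Adj v w) (h : Γ.Adj a c) :
    ∃ b, a ∈ factorSet v w b ∧ c ∈ factorSet v w b := by
  by_cases ha : a = v
  · subst ha
    exact ⟨false, hne, fun hc : c = w => hvw (hc ▸ h)⟩
  by_cases hc : c = v
  · subst hc
    exact ⟨false, fun ha : a = w => hvw (ha ▸ h).symm, hne⟩
  · exact ⟨true, ha, hc⟩

/-- The map to the amalgamated product of the two factors. -/
noncomputable def toPushout {v w : V} (hne : v ≠ w) (hvw : ¬ Γ.Adj v w) :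
    ArtinGroup Γ m →* PushoutI (baseInclusion (factor Γ m v w)) :=
  lift (toPushoutGen Γ m hne) fun a c h => by
    obtain ⟨b, ha, hc⟩ := exists_mem_factorSet hne hvw h
    rw [toPushoutGen_eq hne b ha, toPushoutGen_eq hne b hc, ← map_alternatingProd,
      ← map_alternatingProd]
    congr 1
    apply (factor Γ m v w b).subtype_injective
    rw [map_alternatingProd, map_alternatingProd]
    exact alternatingProd_gen h

theorem toPushout_coe {v w : V} (hne : v ≠ w) (hvw : ¬ Γ.Adj v w) (b : Bool)
    (g : factor Γ m v w b) : toPushout hne hvw (g : ArtinGroup Γ m) = PushoutI.of b g := by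
  obtain ⟨g, hg⟩ := g
  change toPushout hne hvw g = _
  induction hg using Subgroup.closure_induction with
  | mem _ hx =>
    obtain ⟨u, hu, rfl⟩ := hx
    rw [toPushout, lift_gen]
    exact toPushoutGen_eq hne b hu
  | one => exact (map_one _).trans (map_one _).symm
  | mul x y hx hy h1 h2 =>
    rw [map_mul, h1, h2, ← map_mul]
    rfl
  | inv x hx h1 =>
    rw [map_inv, h1, ← map_inv]
    rfl

theorem isTree_cosetGraph_factor {v w : V} (hne : v ≠ w) (hvw : ¬ Γ.Adj v w) :
    (cosetGraph (factor Γ m v w)).IsTree :=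
  isTree_cosetGraph (iSup_factor hne) (toPushout_coe hne hvw)

theorem isParabolic_stabilizer {v w : V} (x : (b : Bool) × (ArtinGroup Γ m ⧸ factor Γ m v w b)) :
    ∃ P : Subgroup (ArtinGroup Γ m), IsParabolic P ∧
      ∀ g, g ∈ P ↔ action (factor Γ m v w) g x = x := by
  obtain ⟨h, hx⟩ := exists_vert_eq _ x
  refine ⟨_, ⟨h, factorSet v w x.1, rfl⟩, fun g => ?_⟩
  rw [hx, action_vert_eq_iff, Subgroup.mem_map_equiv]
  simp [vert, factor]

/-- Each of the two generators lies in exactly one factor, so neither fixes both ends of the base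
edge. -/
theorem not_gen_common_fixedPoint (hm : ∀ e, 2 ≤ m e) {v w : V} (hne : v ≠ w)
    (hvw : ¬ Γ.Adj v w) {x} (hv : action (factor Γ m v w) (gen Γ m v) x = x)
    (hw : action (factor Γ m v w) (gen Γ m w) x = x) : False := by
  rcases notMem_of_common_fixedPoint (isTree_cosetGraph_factor hne hvw) (b := false)
    (gen_mem (by simpa [factorSet] using hne)) (gen_mem (by simpa [factorSet] using hne.symm)) hv hw
    with h | h
  · simpa [factorSet] using (gen_mem_standardParabolic_iff hm).mp h
  · simpa [factorSet] using (gen_mem_standardParabolic_iff hm).mp h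

/-! ### Parabolic closures of FA'-subgroups -/

theorem exists_common_fixedPoint_of_isFAPrimeGroup {v w : V} (hne : v ≠ w) (hvw : ¬ Γ.Adj v w)
    (H : Subgroup (ArtinGroup Γ m)) (hH : IsFAPrimeGroup H) (K : Finset H) :
    ∃ x, ∀ k ∈ K, action (factor Γ m v w) (k : ArtinGroup Γ m) x = x := by
  have hT := isTree_cosetGraph_factor (m := m) hne hvw
  refine hT.exists_forall_apply_eq ((action (factor Γ m v w)).comp H.subtype) ?_ K
  refine hH _ _ hT _ ?_
  rintro g x y ⟨b, h, rfl, rfl⟩ ⟨h1, -⟩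
  have := congrArg Sigma.fst h1
  change b = !b at this
  cases b <;> simp at this

/-- Under (Int++), an `FA'`-subgroup is contained in a complete parabolic subgroup. -/
theorem exists_isCompleteParabolic_of_isFAPrimeGroup [Finite V] (hm : ∀ e, 2 ≤ m e)
    (hInt : PropertyIntPlusPlus Γ m) (H : Subgroup (ArtinGroup Γ m)) (hH : IsFAPrimeGroup H) :
    ∃ P : Subgroup (ArtinGroup Γ m), IsCompleteParabolic P ∧ H ≤ P := by
  classical
  let para : ArtinGroup Γ m → Set V → Subgroup (ArtinGroup Γ m) := fun g X =>
    (standardParabolic Γ m X).map (MulAut.conj g).toMonoidHom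
  have hpara : ∀ g X, IsParabolic (para g X) := fun g X => ⟨g, X, rfl⟩
  have huniv : ∀ S : Set (ArtinGroup Γ m), S ⊆ para 1 Set.univ := by
    intro S s _
    exact ⟨s, by rw [standardParabolic_univ]; exact Subgroup.mem_top s, by simp⟩
  -- A parabolic subgroup of minimal rank above a set is the smallest parabolic subgroup above it.
  have hminimal : ∀ (S : Set (ArtinGroup Γ m)) (g : ArtinGroup Γ m) (X : Set V), S ⊆ para g X →
      (∀ h Y, S ⊆ para h Y → X.ncard ≤ Y.ncard) → ∀ P, IsParabolic P → S ⊆ P → para g X ≤ P := by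
    intro S g X hS hmin P hP hSP
    obtain ⟨h, Y, hY⟩ := hInt _ _ (hpara g X) hP
    have hYS : S ⊆ para h Y := by
      change S ⊆ ((standardParabolic Γ m Y).map (MulAut.conj h).toMonoidHom : Set _)
      rw [← hY]
      exact fun s hs => ⟨hS hs, hSP hs⟩
    have hle : para h Y ≤ para g X := hY.symm.le.trans inf_le_left
    -- The intersection still contains `S`, so minimality of the rank of `X` forces equal ranks.
    have heq : para h Y = para g X :=
      (ncard_le_and_eq_of_map_conj_le hm hle).2 (hmin h Y hYS)
    rw [← heq]
    exact hY.symm.le.trans inf_le_right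
  have hexists : ∀ S : Set (ArtinGroup Γ m), ∃ g X, S ⊆ para g X ∧
      ∀ h Y, S ⊆ para h Y → X.ncard ≤ Y.ncard := by
    intro S
    have hex : ∃ n g X, S ⊆ para g X ∧ X.ncard = n := ⟨_, 1, Set.univ, huniv S, rfl⟩
    obtain ⟨g, X, hS, hn⟩ := Nat.find_spec hex
    exact ⟨g, X, hS, fun h Y hY => hn ▸ Nat.find_min' hex ⟨h, Y, hY, rfl⟩⟩
  obtain ⟨g, X, hHX, hXmin⟩ := hexists H
  refine ⟨para g X, ⟨g, X, ?_, rfl⟩, hHX⟩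
  intro v hv w hw hne
  by_contra hvw
  choose cg cX hc hcmin using hexists
  -- A finite subset of `H` whose parabolic closure has maximal rank.
  obtain ⟨K, hK⟩ : ∃ K : Finset H, ∀ K' : Finset H,
      (cX (((↑) : H → ArtinGroup Γ m) '' K')).ncard ≤
        (cX (((↑) : H → ArtinGroup Γ m) '' K)).ncard := by
    have hfin : (Set.range fun K : Finset H =>
        (cX (((↑) : H → ArtinGroup Γ m) '' K)).ncard).Finite := by
      refine (Set.finite_Iic (Nat.card V)).subset ?_
      rintro _ ⟨K, rfl⟩
      exact Set.ncard_le_card _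
    obtain ⟨_, ⟨K, rfl⟩, hmax⟩ := Set.exists_max_image _ id hfin (Set.range_nonempty _)
    exact ⟨K, fun K' => hmax _ ⟨K', rfl⟩⟩
  set S := ((↑) : H → ArtinGroup Γ m) '' (K : Set H) with hS
  -- Adding any `h` of `H` to `K` can only enlarge the closure. Its rank is already maximal, so the
  -- closure stays the same and contains `h`.
  have hHQ : (H : Set (ArtinGroup Γ m)) ⊆ para (cg S) (cX S) := by
    intro h hh
    set S' := ((↑) : H → ArtinGroup Γ m) '' ((insert ⟨h, hh⟩ K : Finset H) : Set H) with hS'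
    have hSS' : S ⊆ S' := Set.image_mono (by simp)
    have hle : para (cg S) (cX S) ≤ para (cg S') (cX S') :=
      hminimal S _ _ (hc S) (hcmin S) _ (hpara _ _) (hSS'.trans (hc S'))
    have heq : para (cg S) (cX S) = para (cg S') (cX S') :=
      (ncard_le_and_eq_of_map_conj_le hm hle).2 (hK _)
    rw [heq]
    exact hc S' ⟨⟨h, hh⟩, by simp, rfl⟩
  obtain ⟨x, hx⟩ := exists_common_fixedPoint_of_isFAPrimeGroup hne hvw H hH K
  obtain ⟨R, hR, hRx⟩ := isParabolic_stabilizer x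
  have hSR : S ⊆ R := by
    rintro _ ⟨k, hk, rfl⟩
    exact (hRx _).mpr (hx k hk)
  have hQR := hminimal S _ _ (hc S) (hcmin S) R hR hSR
  have hXR := hminimal H g X hHX hXmin R hR (hHQ.trans hQR)
  -- The conjugates by `g` of the generators in `X` fix `x`; translation by `g⁻¹` gives a vertex
  -- fixed by the generators themselves.
  have hfix : ∀ u ∈ X, action (factor Γ m v w) (gen Γ m u)
      (action (factor Γ m v w) g⁻¹ x) = action (factor Γ m v w) g⁻¹ x := by
    intro u hu
    have h1 := (hRx _).mp (hXR ⟨gen Γ m u, gen_mem hu, rfl⟩)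
    have h2 := congrArg (action (factor Γ m v w) g⁻¹) h1
    rw [← RelIso.mul_apply, ← map_mul] at h2
    rw [← RelIso.mul_apply, ← map_mul]
    convert h2 using 3
    simp [mul_assoc]
  exact not_gen_common_fixedPoint hm hne hvw (hfix v hv) (hfix w hw)

end ArtinGroup

theorem mainTheorem3 {V : Type u} [Finite V] (Γ : SimpleGraph V) (m : Γ.edgeSet → ℕ)
    (hm : ∀ e, 2 ≤ m e) (hInt : ArtinGroup.PropertyIntPlusPlus Γ m)
    (H : Subgroup (ArtinGroup Γ m)) (hH : IsFAPrimeGroup H) :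
    ∃ P : Subgroup (ArtinGroup Γ m), ArtinGroup.IsCompleteParabolic P ∧ H ≤ P :=
  ArtinGroup.exists_isCompleteParabolic_of_isFAPrimeGroup hm hInt H hH
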